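/- Let $K_n$ be the complete graph on $n$ vertices and let $A_n\subseteq\mathbb{R}^{n\times n}$ be the (finite) set of adjacency matrices of the Hamiltonian cycles of $K_n$. Let $STSP(n)=\operatorname{Conv}(A_n)$ be the symmetric traveling salesman polytope, regarded as a convex body in the vector space $E_n$ obtained from the affine span of $A_n$ by taking the average of the elements of $A_n$ as origin. Define the two-tier TSP polytope $$2TSP(n)=STSP(n)\otimes STSP(n):=\operatorname{Conv}\{(p,q,p\otimes q): p,q\in STSP(n)\}\subseteq E_n\times E_n\times(E_n\otimes E_n)$$ and, for an integer $m>0$, the Roman army TSP polytope $$RTSP(m,n)=\operatorname{Sym}^m(STSP(n)):=\operatorname{Conv}\{(e_1(p_1,\dots,p_m),\dots,e_m(p_1,\dots,p_m)): p_i\in STSP(n)\}\subseteq\prod_{j=1}^m\operatorname{Sym}^j(E_n),$$ where $e_j$ is the $j$-th elementary symmetric polynomial in $m$ variables, evaluated in the symmetric algebra of $E_n$. **Theorem.** For every integer $d\ge 0$ there is an integer $N(d)>0$ such that, for every $n\ge N(d)$ and every $\{0,1\}$-polytope $P\subseteq\mathbb{R}^d$ (i.e. every polytope all of whose vertices have all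 their components in $\{0,1\}$), the polytope $P$ is affinely isomorphic to a face of $2TSP(n)$ and, for every integer $m>1$, to a face of $RTSP(m,n)$. Here two polytopes are affinely isomorphic if some affine map between their ambient spaces restricts to a bijection between them, and a face of a polytope $C$ is a convex subset $F\subseteq C$ such that whenever a point of $F$ lies in the relative interior of a segment contained in $C$, both end points of the segment lie in $F$. -/

import Mathlib

open scoped TensorProduct

/-- `P ⊆ ℝ^d` is a `{0,1}`-polytope: the convex hull of finitely many points, all of whose
vertices (extreme points) have all components in `{0,1}`. -/
def IsZeroOnePolytope {d : ℕ} (P : Set (Fin d → ℝ)) : Prop :=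
  (∃ S : Finset (Fin d → ℝ), P = convexHull ℝ (S : Set (Fin d → ℝ))) ∧
    ∀ x ∈ P.extremePoints ℝ, ∀ i, x i = 0 ∨ x i = 1

/-- `F` is a face of the convex set `C`: a convex subset that contains both end points of every
segment of `C` having a relative interior point in `F`. The empty set and `C` are faces. -/
def IsFaceOf {V : Type*} [AddCommGroup V] [Module ℝ V] (C F : Set V) : Prop :=
  Convex ℝ F ∧ IsExtreme ℝ C F

/-- Affine isomorphism of convex sets: some affine map of the ambient spaces restricts to a
bijection between them. -/
def AffinelyIsomorphic {V W : Type*} [AddCommGroup V] [Module ℝ V] [AddCommGroup W] [Module ℝ W]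
    (P : Set V) (Q : Set W) : Prop :=
  ∃ f : V →ᵃ[ℝ] W, Set.BijOn f P Q

/-- The tensor product of convex bodies,
`P ⊗ Q = Conv {(p, q, p ⊗ q) : p ∈ P, q ∈ Q} ⊆ E × E' × (E ⊗ E')`. -/
def convexTensor {E E' : Type*} [AddCommGroup E] [Module ℝ E] [AddCommGroup E'] [Module ℝ E']
    (P : Set E) (Q : Set E') : Set (E × E' × (E ⊗[ℝ] E')) :=
  convexHull ℝ {z | ∃ p ∈ P, ∃ q ∈ Q, z = (p, q, p ⊗ₜ[ℝ] q)}

/-- The element `e_j(p₁, …, p_m)` of `Sym^j(E)`, the degree `j` part of the symmetric algebra of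
`E`, where `e_j` is the `j`-th elementary symmetric polynomial in `m` variables. -/
noncomputable def symElem {E : Type*} [AddCommGroup E] [Module ℝ E] {m : ℕ} (p : Fin m → E)
    (j : ℕ) : SymmetricAlgebra ℝ E :=
  MvPolynomial.aeval (fun i => SymmetricAlgebra.ι ℝ E (p i)) (MvPolynomial.esymm (Fin m) ℝ j)

/-- The `m`-th symmetric power of a convex body,
`Sym^m(P) = Conv {(e₁(p₁, …, p_m), …, e_m(p₁, …, p_m)) : p_i ∈ P} ⊆ ∏_{j=1}^m Sym^j(E)`,
each `Sym^j(E)` being regarded as a subspace of the symmetric algebra. The coordinate with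
index `j : Fin m` is the one of degree `j + 1`. -/
def convexSym (m : ℕ) {E : Type*} [AddCommGroup E] [Module ℝ E] (P : Set E) :
    Set (Fin m → SymmetricAlgebra ℝ E) :=
  convexHull ℝ {z | ∃ p : Fin m → E, (∀ i, p i ∈ P) ∧ z = fun j : Fin m => symElem p (j.val + 1)}

open Classical in
/-- The adjacency matrices of the Hamiltonian cycles of the complete graph on `n` vertices. -/
def tourMatrices (n : ℕ) : Set (Matrix (Fin n) (Fin n) ℝ) :=
  {A | ∃ (v : Fin n) (p : (⊤ : SimpleGraph (Fin n)).Walk v v),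
    p.IsHamiltonianCycle ∧ A = p.toSubgraph.spanningCoe.adjMatrix ℝ}

open Classical in
theorem finite_tourMatrices (n : ℕ) : (tourMatrices n).Finite := by
  refine (Set.finite_range fun G : SimpleGraph (Fin n) => G.adjMatrix ℝ).subset ?_
  rintro A ⟨v, p, -, rfl⟩
  exact ⟨_, rfl⟩

/-- The average of the vertices of the symmetric traveling salesman polytope. -/
noncomputable def tourCenter (n : ℕ) : Matrix (Fin n) (Fin n) ℝ :=
  (finite_tourMatrices n).toFinset.centroid ℝ id

/-- The symmetric traveling salesman polytope `STSP(n)`, the convex hull of the tour matrices,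
as a convex body in its affine span with the average of the vertices as origin; this affine span
is thereby identified with its direction `vectorSpan ℝ (tourMatrices n)`. -/
def STSP (n : ℕ) : Set (vectorSpan ℝ (tourMatrices n)) :=
  {x | (x : Matrix (Fin n) (Fin n) ℝ) + tourCenter n ∈ convexHull ℝ (tourMatrices n)}

/-- The two-tier traveling salesman polytope `STSP(n) ⊗ STSP(n)`. -/
def twoTierTSP (n : ℕ) : Set (vectorSpan ℝ (tourMatrices n) × vectorSpan ℝ (tourMatrices n) ×
    (vectorSpan ℝ (tourMatrices n) ⊗[ℝ] vectorSpan ℝ (tourMatrices n))) :=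
  convexTensor (STSP n) (STSP n)

/-- The Roman army traveling salesman polytope `Sym^m(STSP(n))`. -/
def romanTSP (m n : ℕ) : Set (Fin m → SymmetricAlgebra ℝ (vectorSpan ℝ (tourMatrices n))) :=
  convexSym m (STSP n)

/-!
Let `S` be the vertex set of a `0/1`-polytope. By Barrington's theorem a permutation branching
program of width five computes the indicator function of `S`. It gives rise to a layered digraph
with one switch per instruction, in which a position of the switches traces out a tour exactly if
the program accepts. Two switches are forced to agree by routing the arc for position `false` of the
one and the arc for position `true` of the other through the same three new vertices: a tour uses
exactly one of these arcs. Replacing every vertex by a directed path on at least three vertices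
makes the orientation irrelevant, and as the lengths of the paths are arbitrary, every sufficiently
large number of vertices is reached. Hence `Conv S` is affinely isomorphic to the face `F` of
`STSP(n)` cut out by the vanishing of some entries of the tour matrices.

If the affine inequality `0 ≤ h` exposes `F` and `0 ≤ g` exposes a vertex `q`, then
`0 ≤ h(p) + g(p')` exposes a copy of `F × {q}` in the tensor product. For `q ∈ F`, the function
`∑ i, h(p i) + ∑ i ≠ j, g(p i) g(p j)` is affine in `(e₁, e₂)`, and it vanishes exactly if all
`p i` lie in `F` and all but at most one of them equal `q`, which exposes a copy of `F` in the
symmetric power.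
-/

/-! ### Tours -/

/-- A self-map whose functional graph is a single directed cycle through all points. It is encoded
as a map without proper nonempty invariant subsets, which forces `V` to be finite. -/
def IsTour {V : Type*} (f : V → V) : Prop :=
  ∀ s : Set V, s.Nonempty → Set.MapsTo f s s → s = Set.univ

namespace IsTour

variable {V W : Type*} {f : V → V} {g : W → W}

theorem forall_of_closed (hf : IsTour f) {p : V → Prop} {x : V} (hx : p x)
    (hp : ∀ x, p x → p (f x)) (y : V) : p y :=
  (hf {x | p x} ⟨x, hx⟩ hp).ge (Set.mem_univ y)

theorem surjective (hf : IsTour f) : Function.Surjective f := fun y =>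
  hf.forall_of_closed (p := fun z => z ∈ Set.range f) ⟨y, rfl⟩ (fun x _ => ⟨x, rfl⟩) y

theorem exists_iterate_eq (hf : IsTour f) (x y : V) : ∃ k : ℕ, f^[k] x = y :=
  hf.forall_of_closed (p := fun z => ∃ k : ℕ, f^[k] x = z) (x := x) ⟨0, rfl⟩
    (fun _ ⟨k, hk⟩ => ⟨k + 1, by rw [Function.iterate_succ_apply', hk]⟩) y

theorem minimalPeriod_pos (hf : IsTour f) (x : V) : 0 < Function.minimalPeriod f x := by
  obtain ⟨k, hk⟩ := hf.exists_iterate_eq (f x) x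
  exact Function.minimalPeriod_pos_of_mem_periodicPts ⟨k + 1, k.succ_pos, hk⟩

theorem bijective_iterate (hf : IsTour f) (x : V) :
    Function.Bijective fun k : Fin (Function.minimalPeriod f x) => f^[k] x := by
  refine ⟨fun i j hij => Fin.ext ?_, fun y => ?_⟩
  · exact Function.iterate_injOn_Iio_minimalPeriod i.isLt j.isLt hij
  · obtain ⟨k, rfl⟩ := hf.exists_iterate_eq x y
    exact ⟨⟨k % _, Nat.mod_lt _ (hf.minimalPeriod_pos x)⟩,
      Function.iterate_mod_minimalPeriod_eq⟩

protected theorem finite (hf : IsTour f) : Finite V := by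
  rcases isEmpty_or_nonempty V with _ | ⟨⟨x⟩⟩
  · infer_instance
  · exact Finite.of_surjective _ (hf.bijective_iterate x).surjective

theorem minimalPeriod_eq_card (hf : IsTour f) (x : V) :
    Function.minimalPeriod f x = Nat.card V := by
  simpa using Nat.card_congr (Equiv.ofBijective _ (hf.bijective_iterate x))

theorem injective (hf : IsTour f) : Function.Injective f :=
  have := hf.finite
  Finite.injective_iff_surjective.mpr hf.surjective

theorem iterate_ne_self (hf : IsTour f) {k : ℕ} (hk : 0 < k) (hkV : k < Nat.card V) (x : V) :
    f^[k] x ≠ x := fun h =>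
  (Function.IsPeriodicPt.minimalPeriod_le hk h).not_gt (hf.minimalPeriod_eq_card x ▸ hkV)

theorem apply_ne_self [Nontrivial V] (hf : IsTour f) (x : V) : f x ≠ x :=
  have := hf.finite
  hf.iterate_ne_self one_pos Finite.one_lt_card x

theorem apply_apply_ne_self (hf : IsTour f) (hV : 2 < Nat.card V) (x : V) : f (f x) ≠ x :=
  hf.iterate_ne_self two_pos hV x

theorem of_semiconj (hf : IsTour f) {e : V → W} (he : Function.Surjective e)
    (h : Function.Semiconj e f g) : IsTour g := by
  rintro s ⟨y, hy⟩ hs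
  obtain ⟨x, rfl⟩ := he y
  refine Set.eq_univ_of_forall (he.forall.mpr ?_)
  exact hf.forall_of_closed (p := fun z => e z ∈ s) hy fun z hz => h z ▸ hs hz

theorem semiconj_iff (e : V ≃ W) (h : Function.Semiconj e f g) : IsTour f ↔ IsTour g :=
  ⟨fun hf => hf.of_semiconj e.surjective h,
    fun hg => hg.of_semiconj e.symm.surjective (h.inverse_left e.left_inv e.right_inv)⟩

theorem exists_inverse (hf : IsTour f) : ∃ g : V → V, IsTour g ∧ ∀ x y, g x = y ↔ f y = x := by
  let e := Equiv.ofBijective f ⟨hf.injective, hf.surjective⟩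
  refine ⟨e.symm, fun s hs hes => ?_, fun x y => e.symm_apply_eq.trans eq_comm⟩
  by_contra hne
  obtain ⟨x, hx⟩ := (Set.ne_univ_iff_exists_notMem s).mp hne
  obtain ⟨y, hy⟩ := hs
  refine hf.forall_of_closed (p := (· ∉ s)) hx (fun z hz hfz => hz ?_) y hy
  simpa using hes (x := e z) hfz

end IsTour

open Fin.CommRing in
theorem isTour_finRotate (n : ℕ) : IsTour (finRotate (n + 1)) := by
  rintro s ⟨x, hx⟩ hs
  have add_mem : ∀ k : ℕ, x + (k : Fin (n + 1)) ∈ s := by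
    intro k
    induction k with
    | zero => simpa using hx
    | succ k ih => simpa [add_assoc, Nat.cast_succ] using hs ih
  refine Set.eq_univ_of_forall fun y => ?_
  simpa using add_mem (y - x).val

open Classical in
/-- The map obtained from `f` by subdividing the arc that leaves `u` by three new vertices, which
are visited in the order `some b`, `none`, `some !b`. -/
noncomputable def detour {V : Type*} (f : V → V) (u : V) (b : Bool) :
    V ⊕ Option Bool → V ⊕ Option Bool
  | .inl v => if v = u then .inr (some b) else .inl (f v)
  | .inr none => .inr (some !b)
  | .inr (some a) => if a = b then .inr none else .inl (f u)

section Detour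

variable {V : Type*} {f : V → V} {u : V} {b : Bool}

theorem IsTour.of_detour (h : IsTour (detour f u b)) : IsTour f := by
  rintro s ⟨x, hx⟩ hs
  refine Set.eq_univ_of_forall fun y => ?_
  refine h.forall_of_closed (p := fun z => Sum.elim (· ∈ s) (fun _ => u ∈ s) z) (x := .inl x) hx
    ?_ (.inl y)
  rintro (v | _ | a) hz
  · by_cases hv : v = u
    · simpa [detour, hv] using hz
    · simpa [detour, hv] using hs hz
  · simpa [detour] using hz
  · by_cases ha : a = b
    · simpa [detour, ha] using hz
    · simpa [detour, ha] using hs hz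

theorem isTour_detour (h : IsTour f) (u : V) (b : Bool) : IsTour (detour f u b) := by
  rintro s ⟨x, hx⟩ hs
  have enter : .inl u ∈ s → .inr (some b) ∈ s := fun hz => by simpa [detour] using hs hz
  have middle : .inr (some b) ∈ s → .inr none ∈ s := fun hz => by simpa [detour] using hs hz
  have last : .inr none ∈ s → .inr (some !b) ∈ s := fun hz => by simpa [detour] using hs hz
  have leave : .inr (some !b) ∈ s → .inl (f u) ∈ s := fun hz => by simpa [detour] using hs hz
  obtain ⟨v, hv⟩ : ∃ v, .inl v ∈ s := by
    rcases x with v | _ | a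
    · exact ⟨v, hx⟩
    · exact ⟨f u, leave (last hx)⟩
    · rcases Bool.eq_or_eq_not a b with rfl | rfl
      · exact ⟨f u, leave (last (middle hx))⟩
      · exact ⟨f u, leave hx⟩
  have old : ∀ w, .inl w ∈ s := h.forall_of_closed hv fun w hw => by
    by_cases hwu : w = u
    · exact hwu ▸ leave (last (middle (enter (hwu ▸ hw))))
    · simpa [detour, hwu] using hs hw
  have first := enter (old u)
  refine Set.eq_univ_of_forall ?_
  rintro (w | _ | a)
  · exact old w
  · exact middle first
  · rcases Bool.eq_or_eq_not a b with rfl | rfl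
    · exact first
    · exact last (middle first)

theorem IsTour.exists_eq_inl_of_path [Nonempty V] {g : V ⊕ Option Bool → V ⊕ Option Bool}
    (hg : IsTour g) (hb : g (.inr (some b)) = .inr none) (hnone : g (.inr none) = .inr (some !b)) :
    ∃ w, g (.inr (some !b)) = .inl w := by
  rcases h : g (.inr (some !b)) with w | _ | a
  · exact ⟨w, rfl⟩
  · simpa using hg.injective (h.trans hb.symm)
  · rcases Bool.eq_or_eq_not a b with rfl | rfl
    · have hclosed : Set.MapsTo g (Set.range Sum.inr) (Set.range Sum.inr) := by
        rintro _ ⟨_ | c, rfl⟩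
        · exact ⟨_, hnone.symm⟩
        · rcases Bool.eq_or_eq_not c a with rfl | rfl
          · exact ⟨_, hb.symm⟩
          · exact ⟨_, h.symm⟩
      obtain ⟨v⟩ := ‹Nonempty V›
      simpa using (hg _ (Set.range_nonempty _) hclosed).ge (Set.mem_univ (.inl v))
    · simpa using hg.injective (h.trans hnone.symm)

theorem IsTour.exists_eq_detour [Nonempty V] {g : V ⊕ Option Bool → V ⊕ Option Bool}
    (hg : IsTour g) (hb : g (.inr (some b)) = .inr none) (hnone : g (.inr none) = .inr (some !b)) :
    ∃ f u, g = detour f u b := by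
  obtain ⟨w, hw⟩ := hg.exists_eq_inl_of_path hb hnone
  obtain ⟨u, hu⟩ : ∃ u, g (.inl u) = .inr (some b) := by
    obtain ⟨u | _ | a, h⟩ := hg.surjective (.inr (some b))
    · exact ⟨u, h⟩
    · simp [hnone] at h
    · rcases Bool.eq_or_eq_not a b with rfl | rfl
      · simp [hb] at h
      · simp [hw] at h
  have exists_inl (v : V) (hv : v ≠ u) : ∃ x, g (.inl v) = .inl x := by
    rcases h : g (.inl v) with x | _ | a
    · exact ⟨x, rfl⟩
    · simpa using hg.injective (h.trans hb.symm)
    · rcases Bool.eq_or_eq_not a b with rfl | rfl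
      · exact absurd (Sum.inl_injective (hg.injective (h.trans hu.symm))) hv
      · simpa using hg.injective (h.trans hnone.symm)
  have hf (v : V) : ∃ x, (v = u → x = w) ∧ (v ≠ u → g (.inl v) = .inl x) := by
    by_cases hv : v = u
    · exact ⟨w, by simp [hv]⟩
    · simpa [hv] using exists_inl v hv
  choose f hfu hf using hf
  refine ⟨f, u, funext ?_⟩
  rintro (v | _ | a)
  · by_cases hv : v = u
    · simp [detour, hv, hu]
    · simp [detour, hv, hf v hv]
  · simp [detour, hnone]
  · rcases Bool.eq_or_eq_not a b with rfl | rfl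
    · simp [detour, hb]
    · simp [detour, hw, hfu u rfl]

end Detour

/-! ### Barrington's theorem -/

open scoped commutatorElement

/-- The five-cycles of the symmetric group on five letters. -/
def IsFiveCycle (g : Equiv.Perm (Fin 5)) : Prop :=
  IsConj (finRotate 5) g

namespace IsFiveCycle

variable {g : Equiv.Perm (Fin 5)}

theorem isTour (hg : IsFiveCycle g) : IsTour g := by
  obtain ⟨k, rfl⟩ := isConj_iff.mp hg
  exact (IsTour.semiconj_iff k fun x => by simp).mp (isTour_finRotate 4)

theorem inv (hg : IsFiveCycle g) : IsFiveCycle g⁻¹ := by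
  have finRotate_inv : IsConj (finRotate 5) (finRotate 5)⁻¹ :=
    isConj_iff.mpr ⟨⟨![0, 4, 3, 2, 1], ![0, 4, 3, 2, 1], by decide, by decide⟩,
      Equiv.ext (by decide)⟩
  obtain ⟨k, rfl⟩ := isConj_iff.mp hg
  exact finRotate_inv.trans (isConj_iff.mpr ⟨k, by group⟩)

theorem exists_commutator_eq (hg : IsFiveCycle g) :
    ∃ a b, IsFiveCycle a ∧ IsFiveCycle b ∧ ⁅a, b⁆ = g := by
  let u : Equiv.Perm (Fin 5) := ⟨![0, 2, 1, 4, 3], ![0, 2, 1, 4, 3], by decide, by decide⟩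
  let v : Equiv.Perm (Fin 5) := ⟨![0, 1, 4, 2, 3], ![0, 1, 3, 4, 2], by decide, by decide⟩
  have finRotate_eq : ⁅u * finRotate 5 * u⁻¹, v * finRotate 5 * v⁻¹⁆ = finRotate 5 :=
    Equiv.ext (by decide)
  obtain ⟨k, rfl⟩ := isConj_iff.mp hg
  refine ⟨k * (u * finRotate 5 * u⁻¹) * k⁻¹, k * (v * finRotate 5 * v⁻¹) * k⁻¹,
    isConj_iff.mpr ⟨k * u, by group⟩, isConj_iff.mpr ⟨k * v, by group⟩, ?_⟩
  rw [← conjugate_commutatorElement, finRotate_eq]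

end IsFiveCycle

/-- An instruction of a permutation branching program: a variable together with the permutations
to be applied for its two values. -/
structure PermInstr (J X : Type*) where
  /-- The variable that is read. -/
  var : J
  /-- The permutations for the two values of the variable. -/
  perm : Bool → Equiv.Perm X
  /-- The two permutations differ by a cyclic permutation of all of `X`. -/
  isTour : IsTour ⇑((perm false)⁻¹ * perm true)

section Programs

variable {J X : Type*}

/-- The product computed by the permutation branching program `L` on the input `x`. -/
def evalProgram (L : List (PermInstr J X)) (x : J → Bool) : Equiv.Perm X :=
  (L.map fun i => i.perm (x i.var)).prod

open Classical in
/-- Barrington's notion of computing the indicator function of `S`: the program evaluates to `g`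
on the inputs in `S` and to the identity on all others. -/
def ComputesOn (L : List (PermInstr J X)) (S : Set (J → Bool)) (g : Equiv.Perm X) : Prop :=
  ∀ x, evalProgram L x = if x ∈ S then g else 1

theorem evalProgram_append (L L' : List (PermInstr J X)) (x : J → Bool) :
    evalProgram (L ++ L') x = evalProgram L x * evalProgram L' x := by
  simp [evalProgram]

namespace ComputesOn

variable {L L' M M' : List (PermInstr J X)} {S T : Set (J → Bool)} {g a b : Equiv.Perm X}

theorem union (hL : ComputesOn L S g) (hM : ComputesOn M T g) (hST : Disjoint S T) :
    ComputesOn (L ++ M) (S ∪ T) g := by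
  intro x
  rw [evalProgram_append, hL, hM]
  by_cases hS : x ∈ S
  · simp [hS, hST.notMem_of_mem_left hS]
  · by_cases hT : x ∈ T <;> simp [hS, hT]

theorem inter (hL : ComputesOn L S a) (hL' : ComputesOn L' S a⁻¹) (hM : ComputesOn M T b)
    (hM' : ComputesOn M' T b⁻¹) : ComputesOn (L ++ M ++ L' ++ M') (S ∩ T) ⁅a, b⁆ := by
  intro x
  simp only [evalProgram_append, hL x, hL' x, hM x, hM' x, commutatorElement_def]
  by_cases hS : x ∈ S <;> by_cases hT : x ∈ T <;> simp [hS, hT]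

end ComputesOn

theorem exists_computesOn_literal (j : J) (c : Bool) {g : Equiv.Perm (Fin 5)}
    (hg : IsFiveCycle g) :
    ∃ L : List (PermInstr J (Fin 5)), (∃ i ∈ L, i.var = j) ∧ ComputesOn L {x | x j = c} g := by
  refine ⟨[⟨j, fun b => if b = c then g else 1, ?_⟩], by simp, fun x => by simp [evalProgram]⟩
  cases c
  · simpa using hg.inv.isTour
  · simpa using hg.isTour

theorem exists_computesOn_subcube (s : J → Bool) {T : Finset J} (hT : T.Nonempty)
    {g : Equiv.Perm (Fin 5)} (hg : IsFiveCycle g) :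
    ∃ L : List (PermInstr J (Fin 5)), (∀ j ∈ T, ∃ i ∈ L, i.var = j) ∧
      ComputesOn L {x | ∀ j ∈ T, x j = s j} g := by
  induction hT using Finset.Nonempty.cons_induction generalizing g with
  | singleton j => simpa using exists_computesOn_literal j (s j) hg
  | cons j T hj _ ih =>
    obtain ⟨a, b, ha, hb, rfl⟩ := hg.exists_commutator_eq
    obtain ⟨A, hAj, hA⟩ := exists_computesOn_literal j (s j) ha
    obtain ⟨A', -, hA'⟩ := exists_computesOn_literal j (s j) ha.inv
    obtain ⟨B, hBT, hB⟩ := ih hb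
    obtain ⟨B', -, hB'⟩ := ih hb.inv
    refine ⟨A ++ B ++ A' ++ B', ?_, ?_⟩
    · have mono (L : List _) (hL : L ⊆ A ++ B ++ A' ++ B') (k : J) :
          (∃ i ∈ L, i.var = k) → ∃ i ∈ A ++ B ++ A' ++ B', i.var = k :=
        fun ⟨i, hi, hik⟩ => ⟨i, hL hi, hik⟩
      refine Finset.forall_mem_cons hj _ |>.mpr ⟨mono A (by simp) j hAj, fun k hk => ?_⟩
      exact mono B (by simp) k (hBT k hk)
    · simpa only [Finset.forall_mem_cons, Set.ofPred_and] using hA.inter hA' hB hB'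

theorem exists_computesOn [Finite J] [Nonempty J] {S : Set (J → Bool)} (hS : S.Nonempty)
    {g : Equiv.Perm (Fin 5)} (hg : IsFiveCycle g) :
    ∃ L : List (PermInstr J (Fin 5)), (∀ j, ∃ i ∈ L, i.var = j) ∧ ComputesOn L S g := by
  have := Fintype.ofFinite J
  have point (s : J → Bool) :
      ∃ L : List (PermInstr J (Fin 5)), (∀ j, ∃ i ∈ L, i.var = j) ∧ ComputesOn L {s} g := by
    simpa [← funext_iff] using exists_computesOn_subcube s Finset.univ_nonempty hg
  induction S, S.toFinite using Set.Finite.induction_on with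
  | empty => simp at hS
  | @insert s S hs _ ih =>
    obtain ⟨L, hL, hLs⟩ := point s
    rcases S.eq_empty_or_nonempty with rfl | hS
    · exact ⟨L, hL, by simpa using hLs⟩
    · obtain ⟨M, -, hM⟩ := ih hS
      refine ⟨L ++ M, fun j => ?_, hLs.union hM (by simpa using hs)⟩
      obtain ⟨i, hi, hij⟩ := hL j
      exact ⟨i, by simp [hi], hij⟩

end Programs

/-! ### The layered digraph of a permutation branching program -/

section Layered

variable {m : ℕ} {X : Type*}

/-- The map on `m + 1` layers that applies the permutation `τ l` when passing from the layer `l`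
to its cyclic predecessor. The layers are traversed in decreasing order because the last factor of
a product of permutations acts first. -/
def layeredMap (τ : Fin (m + 1) → Equiv.Perm X) (v : Fin (m + 1) × X) : Fin (m + 1) × X :=
  (v.1 - 1, τ v.1 v.2)

open Classical in
/-- The layered map with all permutations trivial except the one of the layer `0`. -/
noncomputable def odometer (m : ℕ) (σ : Equiv.Perm X) : Fin (m + 1) × X → Fin (m + 1) × X :=
  layeredMap (Pi.mulSingle 0 σ)

theorem fin_succ_sub_one (l : Fin m) : l.succ - 1 = l.castSucc := by
  rw [sub_eq_iff_eq_add, Fin.coeSucc_eq_succ]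

theorem IsTour.of_odometer {σ : Equiv.Perm X} (h : IsTour (odometer m σ)) : IsTour σ := by
  intro s hs hcl
  have hclosed : Set.MapsTo (odometer m σ) (Set.univ ×ˢ s) (Set.univ ×ˢ s) := by
    rintro ⟨l, k⟩ ⟨-, hk⟩
    by_cases hl : l = 0
    · simpa [odometer, layeredMap, hl] using hcl hk
    · simpa [odometer, layeredMap, hl] using hk
  have huniv := h _ (Set.univ_nonempty.prod hs) hclosed
  exact Set.eq_univ_of_forall fun k => by simpa using huniv.ge (Set.mem_univ (0, k))

theorem isTour_odometer {σ : Equiv.Perm X} (hσ : IsTour σ) : IsTour (odometer m σ) := by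
  rintro s ⟨⟨l₀, k₀⟩, h₀⟩ hcl
  have wrap (k : X) (hk : (0, k) ∈ s) : (Fin.last m, σ k) ∈ s := by
    simpa [odometer, layeredMap, ← Fin.neg_last] using hcl hk
  have descend (l : Fin m) (k : X) (hk : (l.succ, k) ∈ s) : (l.castSucc, k) ∈ s := by
    simpa [odometer, layeredMap, fin_succ_sub_one] using hcl hk
  have mem_zero (l : Fin (m + 1)) (k : X) : (l, k) ∈ s → (0, k) ∈ s := by
    induction l using Fin.induction with
    | zero => exact id
    | succ l ih => exact fun hk => ih (descend l k hk)
  have zero_mem : ∀ k, (0, k) ∈ s :=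
    hσ.forall_of_closed (mem_zero l₀ k₀ h₀) fun k hk => mem_zero _ _ (wrap k hk)
  refine Set.eq_univ_of_forall fun ⟨l, k⟩ => ?_
  induction l using Fin.reverseInduction with
  | last => simpa using wrap _ (zero_mem (σ.symm k))
  | cast l ih => exact descend l k ih

theorem isTour_layeredMap_iff (τ : Fin (m + 1) → Equiv.Perm X) :
    IsTour (layeredMap τ) ↔ IsTour (List.ofFn τ).prod := by
  let e : Fin (m + 1) × X ≃ Fin (m + 1) × X :=
    (Equiv.refl _).prodShear fun l => Fin.partialProd τ l.succ
  have he : Function.Semiconj e (layeredMap τ) (odometer m (List.ofFn τ).prod) := by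
    rintro ⟨l, k⟩
    cases l using Fin.cases with
    | zero =>
      simp [e, layeredMap, odometer, ← Fin.neg_last, Fin.partialProd, List.take_of_length_le]
    | succ l => simp [e, layeredMap, odometer, fin_succ_sub_one, Fin.partialProd_succ]
  exact (IsTour.semiconj_iff e he).trans ⟨IsTour.of_odometer, isTour_odometer⟩

theorem IsTour.forall_eq_or_forall_eq [Nontrivial X] {σ τ : Equiv.Perm X} (h : IsTour (σ⁻¹ * τ))
    {f : X → X} (hinj : Function.Injective f) (hf : ∀ x, f x = σ x ∨ f x = τ x) :
    (∀ x, f x = σ x) ∨ ∀ x, f x = τ x := by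
  rw [or_iff_not_imp_left, not_forall]
  rintro ⟨x₀, hx₀⟩
  refine h.forall_of_closed (p := fun x => f x = τ x) ((hf x₀).resolve_left hx₀) fun x hx => ?_
  refine (hf _).resolve_left fun hσ => h.apply_ne_self x (hinj ?_)
  rw [hσ, hx]
  simp

end Layered

/-! ### Switch networks -/

universe u

/-- A digraph all of whose arcs have the form `v → next v b` with `b : Bool`, where the choice of
`b` is meant to be governed by the switch `ctrl v : I`. The vertex `node i` is one at which the
position of the switch `i` can be read off. -/
structure SwitchNetwork (V I : Type*) where
  /-- The successor of a vertex for each position of the switch controlling it. -/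
  next : V → Bool → V
  /-- The switch controlling a vertex. -/
  ctrl : V → I
  /-- A vertex with two distinct successors controlled by a given switch. -/
  node : I → V
  ctrl_node (i : I) : ctrl (node i) = i
  next_node_ne (i : I) : next (node i) false ≠ next (node i) true

namespace SwitchNetwork

variable {V I J : Type*} (N : SwitchNetwork V I)

/-- The self-map of the vertices determined by the positions `y` of the switches. -/
def route (y : I → Bool) (v : V) : V :=
  N.next v (y (N.ctrl v))

/-- The positions of the switches for which the route is a tour. -/
def solutions : Set (I → Bool) :=
  {y | IsTour (N.route y)}

/-- In a coherent network the vertices controlled by the same switch make the same choice in each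
tour; thus the tours of the digraph are the routes of the solutions. -/
def Coherent : Prop :=
  ∀ f : V → V, IsTour f → (∀ v, ∃ b, f v = N.next v b) → ∃ y, f = N.route y

variable {N}

theorem next_node_injective (i : I) : Function.Injective (N.next (N.node i)) :=
  Bool.injective_iff.mpr (N.next_node_ne i)

theorem route_node (y : I → Bool) (i : I) : N.route y (N.node i) = N.next (N.node i) (y i) := by
  rw [route, N.ctrl_node]

theorem route_injective : Function.Injective N.route := fun y y' h => funext fun i =>
  N.next_node_injective i (by rw [← route_node, ← route_node, h])

theorem node_injective : Function.Injective N.node :=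
  Function.LeftInverse.injective N.ctrl_node

section Layered

variable {m : ℕ} {X : Type*} [Nontrivial X]

/-- The layered digraph of a permutation branching program, with one switch for each
instruction. -/
noncomputable def layered (π : Fin (m + 1) → Bool → Equiv.Perm X)
    (hπ : ∀ l, IsTour ⇑((π l false)⁻¹ * π l true)) :
    SwitchNetwork (Fin (m + 1) × X) (Fin (m + 1)) where
  next v b := (v.1 - 1, π v.1 b v.2)
  ctrl v := v.1
  node l := (l, Classical.arbitrary X)
  ctrl_node _ := rfl
  next_node_ne l h := (hπ l).apply_ne_self (Classical.arbitrary X) <| by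
    simp [← (Prod.mk.inj h).2]

variable {π : Fin (m + 1) → Bool → Equiv.Perm X}
  {hπ : ∀ l, IsTour ⇑((π l false)⁻¹ * π l true)}

theorem mem_solutions_layered {y : Fin (m + 1) → Bool} :
    y ∈ (layered π hπ).solutions ↔ IsTour (List.ofFn fun l => π l (y l)).prod :=
  isTour_layeredMap_iff fun l => π l (y l)

theorem coherent_layered : (layered π hπ).Coherent := by
  intro f hf hnext
  have fst_eq (l : Fin (m + 1)) (x : X) : (f (l, x)).1 = l - 1 := by
    obtain ⟨b, hb⟩ := hnext (l, x)
    rw [hb]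
    rfl
  have snd_eq (l : Fin (m + 1)) : ∃ b, ∀ x, (f (l, x)).2 = π l b x := by
    have inj : Function.Injective fun x => (f (l, x)).2 := fun x x' h =>
      (Prod.mk.inj (hf.injective (Prod.ext ((fst_eq l x).trans (fst_eq l x').symm) h))).2
    have either (x : X) : (f (l, x)).2 = π l false x ∨ (f (l, x)).2 = π l true x := by
      obtain ⟨b, hb⟩ := hnext (l, x)
      rw [hb]
      cases b
      · exact Or.inl rfl
      · exact Or.inr rfl
    exact ((hπ l).forall_eq_or_forall_eq inj either).elim (⟨false, ·⟩) (⟨true, ·⟩)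
  choose y hy using snd_eq
  exact ⟨y, funext fun ⟨l, x⟩ => Prod.ext (fst_eq l x) (hy l x)⟩

end Layered

section Sync

open Classical in
/-- The network `N` with a gadget that forces the switches `c false` and `c true` to agree. The
three new vertices can only be traversed in the order `some b`, `none`, `some !b` as part of a
detour between `node (c b)` and `next (node (c b)) b`, which requires `c b` to be in position `b`.
The arcs for position `b` at `node (c b)` are replaced by this detour; hence both switches
have position `b`. -/
noncomputable def sync (N : SwitchNetwork V I) (c : Bool → I) :
    SwitchNetwork (V ⊕ Option Bool) I where
  next
    | .inl v, b => if v = N.node (c b) then .inr (some b) else .inl (N.next v b)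
    | .inr none, b => .inr (some !b)
    | .inr (some a), b => if a = b then .inr none else .inl (N.next (N.node (c b)) b)
  ctrl := Sum.elim N.ctrl fun _ => c true
  node i := .inl (N.node i)
  ctrl_node := N.ctrl_node
  next_node_ne i := by
    dsimp only
    split_ifs <;> simp [N.next_node_ne i]

variable {c : Bool → I}

theorem route_sync {y : I → Bool} {b : Bool} (hb : ∀ a, y (c a) = b) :
    (N.sync c).route y = detour (N.route y) (N.node (c b)) b := by
  funext x
  rcases x with v | _ | a
  · have node_iff : v = N.node (c (y (N.ctrl v))) ↔ v = N.node (c b) := by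
      constructor
      · intro hv
        have : y (N.ctrl v) = b := by rw [hv, N.ctrl_node, hb]
        rwa [this] at hv
      · rintro rfl
        rw [N.ctrl_node, hb]
    by_cases hv : v = N.node (c b)
    · simp [route, sync, detour, hv, hb, N.ctrl_node]
    · simp [route, sync, detour, hv, node_iff]
  · simp [route, sync, detour, hb]
  · simp [route, sync, detour, hb, N.ctrl_node]

theorem exists_eq_detour_of_isTour_sync [Nonempty V] {g : V ⊕ Option Bool → V ⊕ Option Bool}
    (hg : IsTour g) (hnext : ∀ x, ∃ b, g x = (N.sync c).next x b) :
    ∃ f u b, g = detour f u b := by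
  obtain ⟨b, hnone⟩ := hnext (.inr none)
  suffices hb : g (.inr (some b)) = .inr none by
    obtain ⟨f, u, h⟩ := hg.exists_eq_detour hb hnone
    exact ⟨f, u, b, h⟩
  obtain ⟨x, hx⟩ := hg.surjective (.inr none)
  obtain ⟨a, ha⟩ := hnext x
  rcases x with v | _ | d
  · simp only [sync, hx] at ha
    split_ifs at ha
    simp at ha
  · simp [sync, hx] at hnone
  · rcases Bool.eq_or_eq_not d b with rfl | rfl
    · exact hx
    · have := hg.finite
      have := Finite.of_injective _ (Sum.inl_injective (α := V) (β := Option Bool))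
      have hcard : 2 < Nat.card (V ⊕ Option Bool) := by simp [Nat.card_sum]
      have hgg : g (g (.inr none)) = .inr none := by rw [hnone]; exact hx
      exact absurd hgg (hg.apply_apply_ne_self hcard _)

theorem exists_route_of_isTour_sync [Nonempty V] (hN : N.Coherent)
    {g : V ⊕ Option Bool → V ⊕ Option Bool} (hg : IsTour g)
    (hnext : ∀ x, ∃ b, g x = (N.sync c).next x b) :
    ∃ y ∈ N.solutions, (∀ a, y (c a) = y (c true)) ∧ g = (N.sync c).route y := by
  obtain ⟨f, u, b, rfl⟩ := exists_eq_detour_of_isTour_sync hg hnext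
  obtain rfl : u = N.node (c b) := by
    obtain ⟨a, ha⟩ := hnext (.inl u)
    by_cases hu : u = N.node (c a)
    · obtain rfl : b = a := by simpa [detour, sync, hu] using ha
      exact hu
    · simp [detour, sync, hu] at ha
  have hfu : f (N.node (c b)) = N.next (N.node (c b)) b := by
    obtain ⟨a, ha⟩ := hnext (.inr (some !b))
    rcases Bool.eq_or_eq_not a b with rfl | rfl
    · simpa [detour, sync] using ha
    · simp [detour, sync] at ha
  obtain ⟨y, rfl⟩ := hN f hg.of_detour fun v => by
    by_cases hv : v = N.node (c b)
    · exact ⟨b, by rw [hv, hfu]⟩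
    · obtain ⟨a, ha⟩ := hnext (.inl v)
      by_cases hva : v = N.node (c a)
      · simp [detour, sync, hv, if_pos hva] at ha
      · exact ⟨a, by simpa [detour, sync, hv, hva] using ha⟩
  have hyb : y (c b) = b := N.next_node_injective _ (by rw [← route_node, hfu])
  have hynb : y (c !b) = b := by
    by_cases hcb : c (!b) = c b
    · rw [hcb, hyb]
    obtain ⟨a, ha⟩ := hnext (.inl (N.node (c !b)))
    rcases Bool.eq_or_eq_not a b with rfl | rfl
    · refine N.next_node_injective (c !a) ?_
      simpa [detour, sync, N.node_injective.ne hcb, route_node] using ha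
    · simp [detour, sync, N.node_injective.ne hcb] at ha
  have hc (a : Bool) : y (c a) = b := by
    rcases Bool.eq_or_eq_not a b with rfl | rfl
    exacts [hyb, hynb]
  exact ⟨y, hg.of_detour, fun a => (hc a).trans (hc true).symm, (route_sync hc).symm⟩

theorem coherent_sync [Nonempty V] (hN : N.Coherent) (c : Bool → I) : (N.sync c).Coherent := by
  intro g hg hnext
  obtain ⟨y, -, -, hy⟩ := exists_route_of_isTour_sync hN hg hnext
  exact ⟨y, hy⟩

theorem solutions_sync [Nonempty V] (hN : N.Coherent) (c : Bool → I) :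
    (N.sync c).solutions = N.solutions ∩ {y | y (c false) = y (c true)} := by
  ext y
  constructor
  · intro hy
    obtain ⟨y', hy', hc, h⟩ := exists_route_of_isTour_sync hN hy fun x => ⟨_, rfl⟩
    rw [route_injective h]
    exact ⟨hy', hc false⟩
  · rintro ⟨hy, hc⟩
    have hc' : ∀ a, y (c a) = y (c true) := Bool.forall_bool.mpr ⟨hc, rfl⟩
    change IsTour _
    rw [route_sync hc']
    exact isTour_detour hy _ _

theorem exists_forall_sync {V : Type u} [Finite V] [Nonempty V] {N : SwitchNetwork V I}
    (hN : N.Coherent) (C : Finset (Bool → I)) :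
    ∃ (W : Type u) (_ : Finite W) (_ : Nonempty W) (M : SwitchNetwork W I),
      M.Coherent ∧ M.solutions = N.solutions ∩ {y | ∀ c ∈ C, y (c false) = y (c true)} := by
  classical
  induction C using Finset.induction_on with
  | empty => exact ⟨V, inferInstance, inferInstance, N, hN, by simp⟩
  | insert c C _ ih =>
    obtain ⟨W, _, _, M, hM, hMC⟩ := ih
    refine ⟨_, inferInstance, inferInstance, M.sync c, coherent_sync hM c, ?_⟩
    rw [solutions_sync hM, hMC, Set.inter_assoc, ← Set.ofPred_and]
    simp only [Finset.forall_mem_insert, and_comm]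

end Sync

/-- The network in which the switch `i` is replaced by a further copy of the switch `var i`. -/
def reindex (N : SwitchNetwork V I) (var : I → J) (sec : J → I)
    (hsec : Function.RightInverse sec var) : SwitchNetwork V J where
  next := N.next
  ctrl := var ∘ N.ctrl
  node := N.node ∘ sec
  ctrl_node j := by simp [N.ctrl_node, hsec j]
  next_node_ne j := N.next_node_ne (sec j)

section Reindex

variable {var : I → J} {sec : J → I} {hsec : Function.RightInverse sec var}

theorem mem_solutions_reindex {x : J → Bool} :
    x ∈ (N.reindex var sec hsec).solutions ↔ x ∘ var ∈ N.solutions :=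
  Iff.rfl

theorem coherent_reindex (hN : N.Coherent)
    (hvar : N.solutions ⊆ {y | ∃ x : J → Bool, y = x ∘ var}) :
    (N.reindex var sec hsec).Coherent := by
  intro f hf hnext
  obtain ⟨y, rfl⟩ := hN f hf hnext
  obtain ⟨x, rfl⟩ := hvar hf
  exact ⟨x, rfl⟩

/-- Switches can be identified by synchronizing all pairs of them that have the same image. -/
theorem exists_identify {V : Type u} [Finite V] [Nonempty V] [Finite I] {N : SwitchNetwork V I}
    (hN : N.Coherent) (hsec : Function.RightInverse sec var) :
    ∃ (W : Type u) (_ : Finite W) (M : SwitchNetwork W J),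
      M.Coherent ∧ M.solutions = {x | x ∘ var ∈ N.solutions} := by
  classical
  have := Fintype.ofFinite I
  obtain ⟨W, _, _, M, hM, hMN⟩ :=
    exists_forall_sync hN (Finset.univ.filter fun c : Bool → I => var (c false) = var (c true))
  simp only [Finset.mem_filter, Finset.mem_univ, true_and] at hMN
  refine ⟨W, inferInstance, M.reindex var sec hsec, coherent_reindex hM fun y hy => ?_, ?_⟩
  · rw [hMN] at hy
    exact ⟨y ∘ sec, funext fun i => hy.2 (fun b => cond b (sec (var i)) i) (hsec (var i)).symm⟩
  · ext x
    rw [mem_solutions_reindex, hMN]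
    exact and_iff_left fun c hc => congrArg x hc

end Reindex

theorem exists_solutions_eq [Finite J] [Nonempty J] {S : Set (J → Bool)} (hS : S.Nonempty) :
    ∃ (V : Type) (_ : Finite V) (N : SwitchNetwork V J), N.Coherent ∧ N.solutions = S := by
  obtain ⟨n, instr, hread, hL⟩ := List.exists_iff_exists_tuple.mp <|
    exists_computesOn hS (IsConj.refl _ : IsFiveCycle (finRotate 5))
  simp only [List.mem_ofFn, exists_exists_eq_and] at hread
  choose sec hsec using hread
  cases n with
  | zero => exact (sec (Classical.arbitrary J)).elim0
  | succ m =>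
  let N := layered (fun l => (instr l).perm) fun l => (instr l).isTour
  have mem_solutions (x : J → Bool) : x ∘ (fun l => (instr l).var) ∈ N.solutions ↔ x ∈ S := by
    have eval_eq : (List.ofFn fun l => (instr l).perm (x (instr l).var)).prod =
        evalProgram (List.ofFn instr) x := by
      simp only [evalProgram, List.map_ofFn, Function.comp_def]
    simp only [N, mem_solutions_layered, Function.comp_def, eval_eq, hL x]
    by_cases hx : x ∈ S
    · simpa [hx] using isTour_finRotate 4
    · simpa [hx] using fun h : IsTour (1 : Equiv.Perm (Fin 5)) => h.apply_ne_self 0 rfl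
  obtain ⟨V, _, M, hM, hMS⟩ := exists_identify (N := N) coherent_layered
    (var := fun l => (instr l).var) hsec
  exact ⟨V, inferInstance, M, hM, hMS.trans (Set.ext mem_solutions)⟩

end SwitchNetwork

/-! ### From directed to undirected tours -/

section Subdivision

variable {V : Type*} {ℓ : V → ℕ} {R : V → V → Prop}

/-- The vertices of the digraph obtained by replacing each vertex `v` of a digraph by a directed
path on `ℓ v + 3` vertices. -/
abbrev PathVertex (ℓ : V → ℕ) : Type _ :=
  Σ v, Fin (ℓ v + 3)

/-- The arcs of the digraph obtained from `(V, R)` by replacing vertices by directed paths. -/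
inductive PathArc (ℓ : V → ℕ) (R : V → V → Prop) : PathVertex ℓ → PathVertex ℓ → Prop
  | step (v : V) (i : Fin (ℓ v + 2)) : PathArc ℓ R ⟨v, i.castSucc⟩ ⟨v, i.succ⟩
  | jump {v w : V} (h : R v w) : PathArc ℓ R ⟨v, Fin.last _⟩ ⟨w, 0⟩

/-- The map induced by `f` after replacing vertices by directed paths. -/
def pathMap (ℓ : V → ℕ) (f : V → V) (x : PathVertex ℓ) : PathVertex ℓ :=
  Fin.lastCases (motive := fun _ => PathVertex ℓ) ⟨f x.1, 0⟩ (fun i => ⟨x.1, i.succ⟩) x.2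

theorem pathMap_last (f : V → V) (v : V) : pathMap ℓ f ⟨v, Fin.last _⟩ = ⟨f v, 0⟩ :=
  Fin.lastCases_last

theorem pathMap_castSucc (f : V → V) (v : V) (i : Fin (ℓ v + 2)) :
    pathMap ℓ f ⟨v, i.castSucc⟩ = ⟨v, i.succ⟩ :=
  Fin.lastCases_castSucc i

theorem PathArc.eq_succ {v : V} {i : Fin (ℓ v + 2)} {y : PathVertex ℓ}
    (h : PathArc ℓ R ⟨v, i.castSucc⟩ y) : y = ⟨v, i.succ⟩ := by
  generalize hx : (⟨v, i.castSucc⟩ : PathVertex ℓ) = x at h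
  cases h with
  | step v' j =>
    obtain ⟨rfl, h⟩ := Sigma.mk.inj_iff.mp hx
    rw [Fin.castSucc_injective _ (eq_of_heq h)]
  | jump =>
    obtain ⟨rfl, h⟩ := Sigma.mk.inj_iff.mp hx
    exact absurd (eq_of_heq h) (Fin.castSucc_ne_last i)

theorem PathArc.eq_castSucc {v : V} {i : Fin (ℓ v + 2)} {x : PathVertex ℓ}
    (h : PathArc ℓ R x ⟨v, i.succ⟩) : x = ⟨v, i.castSucc⟩ := by
  generalize hy : (⟨v, i.succ⟩ : PathVertex ℓ) = y at h
  cases h with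
  | step v' j =>
    obtain ⟨rfl, h⟩ := Sigma.mk.inj_iff.mp hy
    rw [Fin.succ_injective _ (eq_of_heq h)]
  | jump =>
    obtain ⟨rfl, h⟩ := Sigma.mk.inj_iff.mp hy
    exact absurd (eq_of_heq h) (Fin.succ_ne_zero i)

theorem PathArc.exists_of_last {v : V} {y : PathVertex ℓ}
    (h : PathArc ℓ R ⟨v, Fin.last _⟩ y) : ∃ w, R v w ∧ y = ⟨w, 0⟩ := by
  generalize hx : (⟨v, Fin.last _⟩ : PathVertex ℓ) = x at h
  cases h with
  | step v' j =>
    obtain ⟨rfl, h⟩ := Sigma.mk.inj_iff.mp hx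
    exact absurd (eq_of_heq h).symm (Fin.castSucc_ne_last j)
  | jump h =>
    obtain ⟨rfl, -⟩ := Sigma.mk.inj_iff.mp hx
    exact ⟨_, h, rfl⟩

theorem PathArc.val_eq {x y : PathVertex ℓ} (h : PathArc ℓ R x y) :
    (y.2 : ℕ) = x.2 + 1 ∨ (y.2 : ℕ) = 0 ∧ (x.2 : ℕ) = ℓ x.1 + 2 := by
  cases h <;> simp

theorem PathArc.asymm {x y : PathVertex ℓ} (hxy : PathArc ℓ R x y) : ¬ PathArc ℓ R y x :=
  fun hyx => by
    have := hxy.val_eq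
    have := hyx.val_eq
    omega

theorem PathArc.ne {x y : PathVertex ℓ} (h : PathArc ℓ R x y) : x ≠ y := by
  rintro rfl
  exact h.asymm h

theorem pathArc_pathMap {f : V → V} (hf : ∀ v, R v (f v)) (x : PathVertex ℓ) :
    PathArc ℓ R x (pathMap ℓ f x) := by
  obtain ⟨v, i⟩ := x
  induction i using Fin.lastCases with
  | last => simpa only [pathMap_last] using PathArc.jump (hf v)
  | cast i => simpa only [pathMap_castSucc] using PathArc.step v i

theorem isTour_pathMap {f : V → V} (hf : IsTour f) : IsTour (pathMap ℓ f) := by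
  rintro s ⟨⟨v₀, i₀⟩, h₀⟩ hs
  have step (v : V) (i : Fin (ℓ v + 2)) (h : ⟨v, i.castSucc⟩ ∈ s) : ⟨v, i.succ⟩ ∈ s := by
    simpa only [pathMap_castSucc] using hs h
  have jump (v : V) (h : ⟨v, Fin.last _⟩ ∈ s) : ⟨f v, 0⟩ ∈ s := by
    simpa only [pathMap_last] using hs h
  have last_mem (v : V) (i : Fin (ℓ v + 3)) : ⟨v, i⟩ ∈ s → ⟨v, Fin.last _⟩ ∈ s := by
    induction i using Fin.reverseInduction with
    | last => exact id
    | cast i ih => exact fun h => ih (step v i h)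
  have zero_mem : ∀ v, ⟨v, 0⟩ ∈ s :=
    hf.forall_of_closed (jump v₀ (last_mem v₀ i₀ h₀)) fun v hv => jump v (last_mem v 0 hv)
  refine Set.eq_univ_of_forall fun ⟨v, i⟩ => ?_
  induction i using Fin.induction with
  | zero => exact zero_mem v
  | succ i ih => exact step v i ih

theorem IsTour.exists_eq_pathMap {g : PathVertex ℓ → PathVertex ℓ} (hg : IsTour g)
    (harc : ∀ x, PathArc ℓ R x (g x)) :
    ∃ f, IsTour f ∧ (∀ v, R v (f v)) ∧ g = pathMap ℓ f := by
  choose f hfR hf using fun v => (harc ⟨v, Fin.last _⟩).exists_of_last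
  have hgf : g = pathMap ℓ f := by
    funext ⟨v, i⟩
    induction i using Fin.lastCases with
    | last => rw [pathMap_last, hf]
    | cast i => rw [pathMap_castSucc, (harc _).eq_succ]
  refine ⟨f, fun s ⟨v, hv⟩ hs => Set.eq_univ_of_forall fun w => ?_, hfR, hgf⟩
  refine hg.forall_of_closed (p := fun x => x.1 ∈ s) (x := ⟨v, 0⟩) hv (fun ⟨u, i⟩ hu => ?_) ⟨w, 0⟩
  rw [hgf]
  induction i using Fin.lastCases with
  | last => simpa only [pathMap_last] using hs hu
  | cast i => simpa only [pathMap_castSucc] using hu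

theorem two_lt_card_pathVertex [Finite (PathVertex ℓ)] (v : V) : 2 < Nat.card (PathVertex ℓ) := by
  have := Nat.card_le_card_of_injective (β := PathVertex ℓ) (Sigma.mk v) sigma_mk_injective
  rw [Nat.card_eq_fintype_card, Fintype.card_fin] at this
  omega

/-- The only neighbours of the second vertex of a path are the first and the third one. -/
theorem IsTour.apply_zero_or_apply_one {f : PathVertex ℓ → PathVertex ℓ} (hf : IsTour f)
    (hadj : ∀ x, PathArc ℓ R x (f x) ∨ PathArc ℓ R (f x) x) (v : V) :
    f ⟨v, 0⟩ = ⟨v, 1⟩ ∨ f ⟨v, 1⟩ = ⟨v, 0⟩ := by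
  have := hf.finite
  have succ_eq {y : PathVertex ℓ} (h : PathArc ℓ R ⟨v, 1⟩ y) : y = ⟨v, 2⟩ :=
    PathArc.eq_succ (i := 1) h
  have pred_eq {x : PathVertex ℓ} (h : PathArc ℓ R x ⟨v, 1⟩) : x = ⟨v, 0⟩ :=
    PathArc.eq_castSucc (i := 0) h
  obtain ⟨x, hx⟩ := hf.surjective ⟨v, 1⟩
  rcases hadj ⟨v, 1⟩ with hsucc | hpred
  · rcases hx ▸ hadj x with hpred | hsucc'
    · exact Or.inl (pred_eq hpred ▸ hx)
    · have : f (f x) = x := by rw [hx, succ_eq hsucc, succ_eq hsucc']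
      exact absurd this (hf.apply_apply_ne_self (two_lt_card_pathVertex v) x)
  · exact Or.inr (pred_eq hpred)

theorem IsTour.forall_pathArc_or_forall_pathArc {f : PathVertex ℓ → PathVertex ℓ} (hf : IsTour f)
    (hadj : ∀ x, PathArc ℓ R x (f x) ∨ PathArc ℓ R (f x) x) :
    (∀ x, PathArc ℓ R x (f x)) ∨ ∀ x, PathArc ℓ R (f x) x := by
  have := hf.finite
  by_cases hex : ∃ x, PathArc ℓ R x (f x)
  · obtain ⟨x₀, hx₀⟩ := hex
    refine Or.inl (hf.forall_of_closed hx₀ fun x hx => (hadj (f x)).resolve_right fun hback => ?_)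
    obtain ⟨v, i, hfx⟩ : ∃ v i, f x = ⟨v, i⟩ := ⟨_, _, rfl⟩
    cases i using Fin.cases with
    | zero =>
      rw [hfx] at hx hback
      rcases hf.apply_zero_or_apply_one hadj v with h | h
      · rw [h] at hback
        exact (hback.asymm (PathArc.step v 0)).elim
      · rw [← hf.injective (h.trans hfx.symm)] at hx
        exact (hx.asymm (PathArc.step v 0)).elim
    | succ i =>
      have hxx : f (f x) = x := by
        rw [hfx] at hx hback ⊢
        rw [hx.eq_castSucc, hback.eq_castSucc]
      exact hf.apply_apply_ne_self (two_lt_card_pathVertex v) x hxx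
  · exact Or.inr fun x => (hadj x).resolve_left fun h => hex ⟨x, h⟩

theorem IsTour.exists_pathMap_of_undirected {g : PathVertex ℓ → PathVertex ℓ} (hg : IsTour g)
    (hadj : ∀ x, PathArc ℓ R x (g x) ∨ PathArc ℓ R (g x) x) :
    ∃ f, IsTour f ∧ (∀ v, R v (f v)) ∧
      ∀ x y, g x = y ∨ g y = x ↔ pathMap ℓ f x = y ∨ pathMap ℓ f y = x := by
  rcases hg.forall_pathArc_or_forall_pathArc hadj with harc | harc
  · obtain ⟨f, hf, hfR, rfl⟩ := hg.exists_eq_pathMap harc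
    exact ⟨f, hf, hfR, fun _ _ => Iff.rfl⟩
  · obtain ⟨g', hg', hgg'⟩ := hg.exists_inverse
    have harc' (x : PathVertex ℓ) : PathArc ℓ R x (g' x) := by
      simpa only [(hgg' x _).mp rfl] using harc (g' x)
    obtain ⟨f, hf, hfR, rfl⟩ := hg'.exists_eq_pathMap harc'
    exact ⟨f, hf, hfR, fun x y => by rw [hgg', hgg', or_comm]⟩

end Subdivision

/-! ### Tour matrices -/

section TourMatrix

variable {V W : Type*}

open Classical in
/-- The adjacency matrix of the undirected cycle underlying a tour `f`, of which only `f` itself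
is recorded. -/
noncomputable def tourMatrix (f : V → V) : Matrix V V ℝ :=
  fun x y => if f x = y ∨ f y = x then 1 else 0

theorem tourMatrix_congr {f g : V → V}
    (h : ∀ x y, f x = y ∨ f y = x ↔ g x = y ∨ g y = x) : tourMatrix f = tourMatrix g := by
  classical
  ext x y
  exact if_congr (h x y) rfl rfl

theorem reindex_tourMatrix (e : V ≃ W) {f : V → V} {g : W → W} (h : Function.Semiconj e f g) :
    Matrix.reindexLinearEquiv ℝ ℝ e e (tourMatrix f) = tourMatrix g := by
  classical
  ext x y
  obtain ⟨x, rfl⟩ := e.surjective x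
  obtain ⟨y, rfl⟩ := e.surjective y
  simp [tourMatrix, ← h.eq]

/-- The tours of a graph, that is, the orientations of its Hamiltonian cycles. -/
def graphTours (G : SimpleGraph V) : Set (V → V) :=
  {f | IsTour f ∧ ∀ x, G.Adj x (f x)}

theorem tourMatrix_image_graphTours_reindex (e : V ≃ W) (G : SimpleGraph V) :
    tourMatrix '' graphTours (G.comap e.symm) =
      Matrix.reindexLinearEquiv ℝ ℝ e e '' (tourMatrix '' graphTours G) := by
  rw [Set.image_image]
  have semiconj (f : V → V) : Function.Semiconj e f (e ∘ f ∘ e.symm) := fun x => by simp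
  have mem_graphTours (f : V → V) :
      e ∘ f ∘ e.symm ∈ graphTours (G.comap e.symm) ↔ f ∈ graphTours G :=
    and_congr (IsTour.semiconj_iff e (semiconj f)).symm <| by
      simp [e.symm.surjective.forall]
  ext A
  constructor
  · rintro ⟨g, hg, rfl⟩
    have hge : e ∘ (e.symm ∘ g ∘ e) ∘ e.symm = g := by ext; simp
    rw [← hge] at hg ⊢
    exact ⟨_, (mem_graphTours _).mp hg, reindex_tourMatrix e (semiconj _)⟩
  · rintro ⟨f, hf, rfl⟩
    exact ⟨_, (mem_graphTours f).mpr hf, (reindex_tourMatrix e (semiconj f)).symm⟩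

end TourMatrix

/-- The vertex of the unit cube corresponding to a Boolean vector. -/
def cubeVertex {I : Type*} (y : I → Bool) : I → ℝ := fun i => if y i = true then 1 else 0

namespace SwitchNetwork

variable {V I : Type*} (N : SwitchNetwork V I)

section MatrixMap

open Classical in
/-- The affine function on the cube with vertices `y` that indicates whether the route of `y`
uses the arc `v → w`. -/
noncomputable def arcIndicator (v w : V) : (I → ℝ) →ᵃ[ℝ] ℝ :=
  AffineMap.lineMap (if N.next v false = w then (1 : ℝ) else 0)
    (if N.next v true = w then 1 else 0) |>.comp (LinearMap.proj (N.ctrl v)).toAffineMap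

open Classical in
theorem arcIndicator_cubeVertex (v w : V) (y : I → Bool) :
    N.arcIndicator v w (cubeVertex y) = if N.route y v = w then 1 else 0 := by
  cases hy : y (N.ctrl v) <;> simp [arcIndicator, cubeVertex, route, hy]

theorem arcIndicator_node (i : I) (y : I → ℝ) :
    N.arcIndicator (N.node i) (N.next (N.node i) true) y = y i := by
  simp [arcIndicator, N.ctrl_node, N.next_node_ne, AffineMap.lineMap_apply]

/-- The affine map sending the vertices `y` of the cube to the matrices of their routes. -/
noncomputable def matrixMap : (I → ℝ) →ᵃ[ℝ] Matrix V V ℝ :=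
  AffineMap.pi fun v => AffineMap.pi fun w => N.arcIndicator v w + N.arcIndicator w v

theorem matrixMap_apply (y : I → ℝ) (v w : V) :
    N.matrixMap y v w = N.arcIndicator v w y + N.arcIndicator w v y :=
  rfl

/-- A switch network is oriented if its digraph has no directed cycles of length at most two. -/
def Oriented : Prop :=
  ∀ v b b', N.next (N.next v b) b' ≠ v

variable {N}

theorem Oriented.matrixMap_cubeVertex (hN : N.Oriented) (y : I → Bool) :
    N.matrixMap (cubeVertex y) = tourMatrix (N.route y) := by
  classical
  ext v w
  rw [matrixMap_apply, arcIndicator_cubeVertex, arcIndicator_cubeVertex, tourMatrix]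
  by_cases hvw : N.route y v = w
  · have hwv : N.route y w ≠ v := hvw ▸ hN v _ _
    simp [hvw, hwv]
  · rw [if_neg hvw, zero_add]
    exact if_congr (or_iff_right hvw).symm rfl rfl

theorem Oriented.matrixMap_injective (hN : N.Oriented) : Function.Injective N.matrixMap := by
  have entry (y : I → ℝ) (i : I) :
      N.matrixMap y (N.node i) (N.next (N.node i) true) = y i := by
    have back : N.arcIndicator (N.next (N.node i) true) (N.node i) y = 0 := by
      simp [arcIndicator, hN _ true]
    rw [matrixMap_apply, arcIndicator_node, back, add_zero]
  intro y y' h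
  ext i
  rw [← entry y, ← entry y', h]

end MatrixMap

section Subdivide

/-- The network in which every vertex `v` is replaced by a directed path on `ℓ v + 3` vertices. -/
def subdivide (ℓ : V → ℕ) : SwitchNetwork (PathVertex ℓ) I where
  next x b := pathMap ℓ (N.next · b) x
  ctrl x := N.ctrl x.1
  node i := ⟨N.node i, Fin.last _⟩
  ctrl_node i := N.ctrl_node i
  next_node_ne i h := N.next_node_ne i (congrArg Sigma.fst (by simpa only [pathMap_last] using h))

variable {ℓ : V → ℕ}

theorem pathMap_route (y : I → Bool) : pathMap ℓ (N.route y) = (N.subdivide ℓ).route y := by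
  funext ⟨v, i⟩
  induction i using Fin.lastCases with
  | last => simp only [route, subdivide, pathMap_last]; rfl
  | cast i => simp only [route, subdivide, pathMap_castSucc]

theorem oriented_subdivide : (N.subdivide ℓ).Oriented := by
  intro x b b' h
  have arc (x : PathVertex ℓ) (b : Bool) :
      PathArc ℓ (fun _ _ => True) x ((N.subdivide ℓ).next x b) :=
    pathArc_pathMap (f := (N.next · b)) (fun _ => trivial) x
  have back := arc ((N.subdivide ℓ).next x b) b'
  rw [h] at back
  exact (arc x b).asymm back

/-- The undirected graph underlying the digraph of the subdivided network. -/
def subdivideGraph (ℓ : V → ℕ) : SimpleGraph (PathVertex ℓ) :=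
  SimpleGraph.fromRel (PathArc ℓ fun v w => ∃ b, w = N.next v b)

variable {N}

theorem Coherent.tourMatrix_image_graphTours (hN : N.Coherent) :
    tourMatrix '' graphTours (N.subdivideGraph ℓ) =
      (N.subdivide ℓ).matrixMap '' (cubeVertex '' N.solutions) := by
  simp only [Set.image_image, N.oriented_subdivide.matrixMap_cubeVertex, ← pathMap_route]
  ext A
  constructor
  · rintro ⟨g, ⟨hg, hadj⟩, rfl⟩
    obtain ⟨f, hf, hnext, hgf⟩ :=
      hg.exists_pathMap_of_undirected fun x => ((SimpleGraph.fromRel_adj _ _ _).mp (hadj x)).2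
    obtain ⟨y, rfl⟩ := hN f hf hnext
    exact ⟨y, hf, (tourMatrix_congr hgf).symm⟩
  · rintro ⟨y, hy, rfl⟩
    refine ⟨_, ⟨isTour_pathMap hy, fun x => ?_⟩, rfl⟩
    have harc := pathArc_pathMap (ℓ := ℓ) (f := N.route y)
      (R := fun v w => ∃ b, w = N.next v b) (fun _ => ⟨_, rfl⟩) x
    exact (SimpleGraph.fromRel_adj _ _ _).mpr ⟨harc.ne, Or.inl harc⟩

end Subdivide

end SwitchNetwork

theorem exists_card_pathVertex_eq {V : Type*} [Fintype V] [Nonempty V] {n : ℕ}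
    (hn : 3 * Fintype.card V ≤ n) : ∃ ℓ : V → ℕ, Fintype.card (PathVertex ℓ) = n := by
  classical
  refine ⟨Pi.single (Classical.arbitrary V) (n - 3 * Fintype.card V), ?_⟩
  simp only [Fintype.card_sigma, Fintype.card_fin, Finset.sum_add_distrib, Finset.sum_pi_single',
    Finset.mem_univ, ↓reduceIte, Finset.sum_const, Finset.card_univ, smul_eq_mul]
  omega

theorem exists_affine_image_eq_tourMatrix_image {J : Type*} [Finite J] [Nonempty J]
    {S : Set (J → Bool)} (hS : S.Nonempty) :
    ∃ N, 3 ≤ N ∧ ∀ n ≥ N, ∃ (G : SimpleGraph (Fin n))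
      (T : (J → ℝ) →ᵃ[ℝ] Matrix (Fin n) (Fin n) ℝ), Function.Injective T ∧
        T '' (cubeVertex '' S) = tourMatrix '' graphTours G := by
  obtain ⟨V, _, N, hN, rfl⟩ := SwitchNetwork.exists_solutions_eq hS
  have := Fintype.ofFinite V
  have : Nonempty V := ⟨N.node (Classical.arbitrary J)⟩
  have : 0 < Fintype.card V := Fintype.card_pos
  refine ⟨3 * Fintype.card V, by omega, fun n hn => ?_⟩
  obtain ⟨ℓ, hℓ⟩ := exists_card_pathVertex_eq hn
  let e : PathVertex ℓ ≃ Fin n := Fintype.equivFinOfCardEq hℓ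
  refine ⟨(N.subdivideGraph ℓ).comap e.symm,
    (Matrix.reindexLinearEquiv ℝ ℝ e e).toLinearMap.toAffineMap.comp (N.subdivide ℓ).matrixMap,
    (Matrix.reindexLinearEquiv ℝ ℝ e e).injective.comp N.oriented_subdivide.matrixMap_injective, ?_⟩
  rw [tourMatrix_image_graphTours_reindex, hN.tourMatrix_image_graphTours, AffineMap.coe_comp,
    Set.image_comp]
  rfl

/-! ### Tours and Hamiltonian cycles -/

theorem IsTour.exists_semiconj_finRotate {V : Type*} {f : V → V} (hf : IsTour f) {m : ℕ}
    (hV : Nat.card V = m + 1) :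
    ∃ e : Fin (m + 1) ≃ V, Function.Semiconj e (finRotate (m + 1)) f := by
  obtain ⟨x⟩ : Nonempty V := (Nat.card_pos_iff.mp (by omega)).1
  have period : Function.minimalPeriod f x = m + 1 := (hf.minimalPeriod_eq_card x).trans hV
  have bij := hf.bijective_iterate x
  rw [period] at bij
  refine ⟨Equiv.ofBijective _ bij, fun i => ?_⟩
  induction i using Fin.lastCases with
  | last =>
    have := Function.isPeriodicPt_minimalPeriod f x
    rw [period] at this
    simpa [Function.iterate_succ_apply'] using this.eq.symm
  | cast i => simp [Function.iterate_succ_apply']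

section Walk

variable {V : Type*} {G : SimpleGraph V} {v : V} {p : G.Walk v v} {f : V → V}

theorem toSubgraph_adj_iff_apply_eq (hf : ∀ i < p.length, f (p.getVert i) = p.getVert (i + 1))
    (hsurj : ∀ x, ∃ i < p.length, p.getVert i = x) (x y : V) :
    p.toSubgraph.Adj x y ↔ f x = y ∨ f y = x := by
  rw [SimpleGraph.Walk.toSubgraph_adj_iff]
  constructor
  · rintro ⟨i, h, hi⟩
    rw [← hf i hi, Sym2.eq_iff] at h
    rcases h with ⟨rfl, rfl⟩ | ⟨rfl, rfl⟩
    · exact Or.inl rfl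
    · exact Or.inr rfl
  · rintro (rfl | rfl)
    · obtain ⟨i, hi, rfl⟩ := hsurj x
      exact ⟨i, by rw [hf i hi], hi⟩
    · obtain ⟨i, hi, rfl⟩ := hsurj y
      exact ⟨i, by rw [hf i hi, Sym2.eq_swap], hi⟩

variable [DecidableEq V]

theorem exists_isTour_of_isHamiltonianCycle (hp : p.IsHamiltonianCycle) :
    ∃ f : V → V, IsTour f ∧ ∀ x y, p.toSubgraph.Adj x y ↔ f x = y ∨ f y = x := by
  obtain ⟨m, hm⟩ : ∃ m, p.length = m + 1 := ⟨p.length - 1, by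
    have := hp.isCycle.three_le_length
    omega⟩
  have surj (x : V) : ∃ i < p.length, p.getVert i = x := by
    obtain ⟨i, rfl, hi⟩ := SimpleGraph.Walk.mem_support_iff_exists_getVert.mp (hp.mem_support x)
    rcases hi.lt_or_eq with hi | rfl
    · exact ⟨i, hi, rfl⟩
    · exact ⟨0, by omega, by simp⟩
  have bij : Function.Bijective fun i : Fin (m + 1) => p.getVert i := by
    refine ⟨fun i j hij => Fin.ext (hp.isCycle.getVert_injOn' ?_ ?_ hij), fun x => ?_⟩
    · rw [Set.mem_ofPred_eq]
      omega
    · rw [Set.mem_ofPred_eq]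
      omega
    · obtain ⟨i, hi, rfl⟩ := surj x
      exact ⟨⟨i, hm ▸ hi⟩, rfl⟩
  let e : Fin (m + 1) ≃ V := Equiv.ofBijective _ bij
  have getVert_succ (i : Fin (m + 1)) : e (finRotate (m + 1) i) = p.getVert (i + 1) := by
    induction i using Fin.lastCases with
    | last => simp [e, ← hm]
    | cast i => simp [e]
  have semiconj : Function.Semiconj e (finRotate (m + 1)) (e ∘ finRotate (m + 1) ∘ e.symm) :=
    fun i => by simp
  refine ⟨_, (IsTour.semiconj_iff e semiconj).mp (isTour_finRotate m),
    toSubgraph_adj_iff_apply_eq (fun i hi => ?_) surj⟩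
  exact (semiconj ⟨i, hm ▸ hi⟩).symm.trans (getVert_succ ⟨i, hm ▸ hi⟩)

open Fin.CommRing in
theorem IsTour.exists_isHamiltonianCycle [Fintype V] (hf : IsTour f) (hV : 3 ≤ Fintype.card V) :
    ∃ (v : V) (p : (⊤ : SimpleGraph V).Walk v v), p.IsHamiltonianCycle ∧
      ∀ x y, p.toSubgraph.Adj x y ↔ f x = y ∨ f y = x := by
  obtain ⟨m, hm⟩ := Nat.exists_eq_add_of_le' hV
  obtain ⟨e, he⟩ := hf.exists_semiconj_finRotate (Nat.card_eq_fintype_card.trans hm)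
  let φ : SimpleGraph.cycleGraph (m + 3) →g (⊤ : SimpleGraph V) :=
    ⟨fun i => e (-i), fun h => (e.injective.comp neg_injective).ne h.ne⟩
  let p := (SimpleGraph.cycleGraph.cycle m).map φ
  have cycle : p.IsCycle := (SimpleGraph.Walk.isCycle_map_iff_of_injective
    (e.injective.comp neg_injective)).mpr SimpleGraph.cycleGraph.isCycle_cycle
  have length_eq : p.length = m + 3 := by simp [p]
  have getVert_eq {i : ℕ} (hi : i ≤ m + 3) : p.getVert i = e i := by
    simp only [p, SimpleGraph.Walk.getVert_map, SimpleGraph.cycleGraph.getVert_cycle hi]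
    refine congrArg e ?_
    change -((m + 3 - i : ℕ) : Fin (m + 3)) = i
    rw [Nat.cast_sub hi, Fin.natCast_self, zero_sub, neg_neg]
  refine ⟨_, p, SimpleGraph.Walk.isHamiltonianCycle_iff_isCycle_and_length_eq.mpr
    ⟨cycle, length_eq.trans hm.symm⟩, toSubgraph_adj_iff_apply_eq (fun i hi => ?_) fun x => ?_⟩
  · rw [getVert_eq (by omega), getVert_eq (by omega), ← he.eq, finRotate_apply, Nat.cast_succ]
  · obtain ⟨i, rfl⟩ := e.surjective x
    exact ⟨i, by omega, by rw [getVert_eq i.isLt.le, Fin.cast_val_eq_self]⟩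

end Walk

theorem adjMatrix_eq_tourMatrix {V : Type*} {H : SimpleGraph V} [DecidableRel H.Adj] {f : V → V}
    (h : ∀ x y, H.Adj x y ↔ f x = y ∨ f y = x) : H.adjMatrix ℝ = tourMatrix f := by
  classical
  ext x y
  exact if_congr (h x y) rfl rfl

theorem mem_tourMatrices_iff {n : ℕ} (hn : 3 ≤ n) {A : Matrix (Fin n) (Fin n) ℝ} :
    A ∈ tourMatrices n ↔ ∃ f, IsTour f ∧ A = tourMatrix f := by
  classical
  constructor
  · rintro ⟨v, p, hp, rfl⟩
    obtain ⟨f, hf, hadj⟩ := exists_isTour_of_isHamiltonianCycle hp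
    exact ⟨f, hf, adjMatrix_eq_tourMatrix hadj⟩
  · rintro ⟨f, hf, rfl⟩
    obtain ⟨v, p, hp, hadj⟩ := hf.exists_isHamiltonianCycle (by simpa using hn)
    exact ⟨v, p, hp, (adjMatrix_eq_tourMatrix hadj).symm⟩

theorem tourMatrix_image_graphTours {n : ℕ} (hn : 3 ≤ n) (G : SimpleGraph (Fin n)) :
    tourMatrix '' graphTours G = {A ∈ tourMatrices n | ∀ x y, ¬ G.Adj x y → A x y = 0} := by
  ext A
  rw [Set.mem_sep_iff, mem_tourMatrices_iff hn]
  constructor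
  · rintro ⟨f, ⟨hf, hadj⟩, rfl⟩
    refine ⟨⟨f, hf, rfl⟩, fun x y hxy => if_neg ?_⟩
    rintro (rfl | rfl)
    · exact hxy (hadj x)
    · exact hxy (hadj y).symm
  · rintro ⟨⟨f, hf, rfl⟩, hG⟩
    refine ⟨f, ⟨hf, fun x => ?_⟩, rfl⟩
    by_contra hx
    simpa [tourMatrix] using hG x (f x) hx

/-! ### Exposed faces -/

theorem AffinelyIsomorphic.image {V E W : Type*} [AddCommGroup V] [Module ℝ V] [AddCommGroup E]
    [Module ℝ E] [AddCommGroup W] [Module ℝ W] {P : Set V} {F : Set E}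
    (h : AffinelyIsomorphic P F) {ψ : E →ᵃ[ℝ] W} (hψ : Function.Injective ψ) :
    AffinelyIsomorphic P (ψ '' F) := by
  obtain ⟨f, hf⟩ := h
  exact ⟨ψ.comp f, hψ.injOn.bijOn_image.comp hf⟩

theorem AffinelyIsomorphic.preimage {V E W : Type*} [AddCommGroup V] [Module ℝ V]
    [AddCommGroup E] [Module ℝ E] [AddCommGroup W] [Module ℝ W] {P : Set V} {F : Set W}
    (h : AffinelyIsomorphic P F) {ι : E →ᵃ[ℝ] W} (hι : Function.Injective ι)
    (hF : F ⊆ Set.range ι) : AffinelyIsomorphic P (ι ⁻¹' F) := by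
  obtain ⟨f, hf⟩ := h
  obtain ⟨ρ, hρ⟩ := ι.linear.exists_leftInverse_of_injective
    (LinearMap.ker_eq_bot.mpr (ι.linear_injective_iff.mpr hι))
  let r : W →ᵃ[ℝ] E := ρ.toAffineMap.comp (AffineMap.id ℝ W - AffineMap.const ℝ W (ι 0))
  have left_inv (x : E) : r (ι x) = x := by
    have : ι x - ι 0 = ι.linear x := by simpa using (ι.linearMap_vsub x 0).symm
    simpa [r, this] using LinearMap.congr_fun hρ x
  have right_inv : ∀ y ∈ F, ι (r y) = y := fun y hy => by
    obtain ⟨x, rfl⟩ := hF hy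
    rw [left_inv]
  have bij : Set.BijOn r F (ι ⁻¹' F) := Set.InvOn.bijOn ⟨right_inv, fun x _ => left_inv x⟩
    (fun y hy => by rwa [Set.mem_preimage, right_inv y hy]) fun _ hx => hx
  exact ⟨r.comp f, bij.comp hf⟩

theorem isFaceOf_empty {E : Type*} [AddCommGroup E] [Module ℝ E] (K : Set E) : IsFaceOf K ∅ :=
  ⟨convex_empty, K.empty_subset, fun _ _ _ _ _ hz => hz.elim⟩

theorem affinelyIsomorphic_empty (V W : Type*) [AddCommGroup V] [Module ℝ V] [AddCommGroup W]
    [Module ℝ W] : AffinelyIsomorphic (∅ : Set V) (∅ : Set W) :=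
  ⟨AffineMap.const ℝ V 0, Set.bijOn_empty _⟩

/-- The affine inequality `0 ≤ h` is valid on `K` and `F` is the set of points of `K` at which it
is tight. Unlike for `IsExposed`, no topology is involved and the inequality is part of the data:
it is used to build inequalities for tensor products and symmetric powers. -/
structure Exposes {E : Type*} [AddCommGroup E] [Module ℝ E] (h : E →ᵃ[ℝ] ℝ) (K F : Set E) :
    Prop where
  nonneg : ∀ p ∈ K, 0 ≤ h p
  mem_iff : ∀ p, p ∈ F ↔ p ∈ K ∧ h p = 0

namespace Exposes

variable {E W : Type*} [AddCommGroup E] [Module ℝ E] [AddCommGroup W] [Module ℝ W]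
  {h : E →ᵃ[ℝ] ℝ} {K F : Set E}

theorem subset (hF : Exposes h K F) : F ⊆ K :=
  fun p hp => ((hF.mem_iff p).mp hp).1

theorem eq_zero (hF : Exposes h K F) {p : E} (hp : p ∈ F) : h p = 0 :=
  ((hF.mem_iff p).mp hp).2

theorem isFaceOf (hF : Exposes h K F) (hconv : Convex ℝ F) : IsFaceOf K F := by
  refine ⟨hconv, hF.subset, ?_⟩
  rintro x hx y hy z hz ⟨a, b, ha, hb, hab, rfl⟩
  refine (hF.mem_iff x).mpr ⟨hx, ?_⟩
  have hcombo := hF.eq_zero hz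
  rw [Convex.combo_affine_apply hab, smul_eq_mul, smul_eq_mul, add_eq_zero_iff_of_nonneg
    (mul_nonneg ha.le (hF.nonneg x hx)) (mul_nonneg hb.le (hF.nonneg y hy))] at hcombo
  exact (mul_eq_zero.mp hcombo.1).resolve_left ha.ne'

theorem preimage (hF : Exposes h K F) (ι : W →ᵃ[ℝ] E) :
    Exposes (h.comp ι) (ι ⁻¹' K) (ι ⁻¹' F) :=
  ⟨fun p hp => hF.nonneg (ι p) hp, fun p => hF.mem_iff (ι p)⟩

protected theorem convexHull (hF : Exposes h K F) :
    Exposes h (convexHull ℝ K) (convexHull ℝ F) := by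
  have zero : convexHull ℝ F ⊆ {x | h x = 0} :=
    convexHull_min (fun x hx => hF.eq_zero hx) ((convex_singleton (0 : ℝ)).affine_preimage h)
  have key : convexHull ℝ K ⊆ {x | 0 ≤ h x ∧ (h x = 0 → x ∈ convexHull ℝ F)} := by
    refine convexHull_min (fun x hx => ⟨hF.nonneg x hx, fun h0 =>
      subset_convexHull ℝ F ((hF.mem_iff x).mpr ⟨hx, h0⟩)⟩) (convex_iff_forall_pos.mpr ?_)
    rintro x ⟨hx, hxF⟩ y ⟨hy, hyF⟩ a b ha hb hab
    rw [Set.mem_ofPred_eq, Convex.combo_affine_apply hab, smul_eq_mul, smul_eq_mul]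
    refine ⟨by positivity, fun h0 => ?_⟩
    rw [add_eq_zero_iff_of_nonneg (by positivity) (by positivity), mul_eq_zero_iff_left ha.ne',
      mul_eq_zero_iff_left hb.ne'] at h0
    exact convex_convexHull ℝ F (hxF h0.1) (hyF h0.2) ha.le hb.le hab
  exact ⟨fun x hx => (key hx).1, fun x =>
    ⟨fun hx => ⟨convexHull_mono hF.subset hx, zero hx⟩, fun hx => (key hx.1).2 hx.2⟩⟩

theorem isFaceOf_convexHull_image {A : Set W} {H : W →ᵃ[ℝ] ℝ} {ψ : E →ᵃ[ℝ] W}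
    (hA : Exposes H A (ψ '' F)) (hF : Convex ℝ F) : IsFaceOf (convexHull ℝ A) (ψ '' F) := by
  have hψF := hF.affine_image ψ
  simpa only [hψF.convexHull_eq] using hA.convexHull.isFaceOf (convex_convexHull ℝ _)

end Exposes

/-! ### Faces of tensor products and symmetric powers -/

theorem Exposes.exists_isFaceOf_convexTensor {E W : Type*} [AddCommGroup E] [Module ℝ E]
    [AddCommGroup W] [Module ℝ W] {h : E →ᵃ[ℝ] ℝ} {g : W →ᵃ[ℝ] ℝ} {K F : Set E} {L : Set W} {q : W}
    (hF : Exposes h K F) (hconv : Convex ℝ F) (hq : Exposes g L {q}) :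
    ∃ ψ : E →ᵃ[ℝ] E × W × (E ⊗[ℝ] W), Function.Injective ψ ∧
      IsFaceOf (convexTensor K L) (ψ '' F) := by
  let ψ : E →ᵃ[ℝ] E × W × (E ⊗[ℝ] W) := (AffineMap.id ℝ E).prod
    ((AffineMap.const ℝ E q).prod ((TensorProduct.mk ℝ E W).flip q).toAffineMap)
  let H : E × W × (E ⊗[ℝ] W) →ᵃ[ℝ] ℝ :=
    h.comp AffineMap.fst + g.comp (AffineMap.fst.comp AffineMap.snd)
  refine ⟨ψ, fun p p' hpp => (Prod.mk.inj hpp).1,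
    Exposes.isFaceOf_convexHull_image (H := H) ⟨?_, ?_⟩ hconv⟩
  · rintro _ ⟨p, hp, r, hr, rfl⟩
    exact add_nonneg (hF.nonneg p hp) (hq.nonneg r hr)
  · refine fun z => ⟨?_, ?_⟩
    · rintro ⟨p, hp, rfl⟩
      have hH : h p + g q = 0 := by rw [hF.eq_zero hp, hq.eq_zero rfl, add_zero]
      exact ⟨⟨p, hF.subset hp, q, hq.subset rfl, rfl⟩, hH⟩
    · rintro ⟨⟨p, hp, r, hr, rfl⟩, h0⟩
      change h p + g r = 0 at h0
      rw [add_eq_zero_iff_of_nonneg (hF.nonneg p hp) (hq.nonneg r hr)] at h0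
      obtain rfl : r = q := (hq.mem_iff r).mpr ⟨hr, h0.2⟩
      exact ⟨p, (hF.mem_iff p).mpr ⟨hp, h0.1⟩, rfl⟩

section SymmetricPower

variable {E : Type*} [AddCommGroup E] [Module ℝ E] {m : ℕ}

theorem injective_symmetricAlgebra_ι : Function.Injective (SymmetricAlgebra.ι ℝ E) := by
  refine (injective_iff_map_eq_zero _).mpr fun x hx => ?_
  refine (Module.forall_dual_apply_eq_zero_iff ℝ x).mp fun l => ?_
  rw [← SymmetricAlgebra.lift_ι_apply (f := l), hx, map_zero]

theorem symElem_eq_sum (p : Fin m → E) (j : ℕ) :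
    symElem p j = ∑ t ∈ Finset.powersetCard j Finset.univ,
      ∏ i ∈ t, SymmetricAlgebra.ι ℝ E (p i) := by
  simp [symElem, MvPolynomial.esymm]

theorem symElem_one (p : Fin m → E) : symElem p 1 = ∑ i, SymmetricAlgebra.ι ℝ E (p i) := by
  simp [symElem]

theorem symElem_comp_perm (p : Fin m → E) (e : Equiv.Perm (Fin m)) (j : ℕ) :
    symElem (p ∘ e) j = symElem p j := by
  have h := congrArg (MvPolynomial.aeval fun i => SymmetricAlgebra.ι ℝ E (p i))
    (MvPolynomial.rename_esymm (Fin m) ℝ j e)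
  rwa [MvPolynomial.aeval_rename] at h

theorem symElem_update_const (q p : E) (i i' : Fin m) (j : ℕ) :
    symElem (Function.update (fun _ => q) i p) j =
      symElem (Function.update (fun _ => q) i' p) j := by
  rw [← symElem_comp_perm _ (Equiv.swap i i'), Function.update_comp_equiv, Equiv.symm_swap,
    Equiv.swap_apply_left]
  rfl

theorem exists_symElem_update_eq (v : Fin m → E) (i : Fin m) (j : ℕ) :
    ∃ a b : SymmetricAlgebra ℝ E, ∀ p,
      symElem (Function.update v i p) j = SymmetricAlgebra.ι ℝ E p * a + b := by
  refine ⟨∑ t ∈ Finset.powersetCard j Finset.univ with i ∈ t,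
      ∏ k ∈ t \ {i}, SymmetricAlgebra.ι ℝ E (v k),
    ∑ t ∈ Finset.powersetCard j Finset.univ with i ∉ t, ∏ k ∈ t, SymmetricAlgebra.ι ℝ E (v k),
    fun p => ?_⟩
  have hupdate (k : Fin m) : SymmetricAlgebra.ι ℝ E (Function.update v i p k) =
      Function.update (SymmetricAlgebra.ι ℝ E ∘ v) i (SymmetricAlgebra.ι ℝ E p) k :=
    congrFun (Function.comp_update _ v i p) k
  simp only [symElem_eq_sum, hupdate]
  rw [← Finset.sum_filter_add_sum_filter_not _ (i ∈ ·), Finset.mul_sum]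
  congr 1
  · exact Finset.sum_congr rfl fun t ht => Finset.prod_update_of_mem (Finset.mem_filter.mp ht).2 ..
  · exact Finset.sum_congr rfl fun t ht =>
      Finset.prod_update_of_notMem (Finset.mem_filter.mp ht).2 ..

theorem exists_affineMap_symElem_update (hm : 0 < m) (v : Fin m → E) (i : Fin m) :
    ∃ ψ : E →ᵃ[ℝ] Fin m → SymmetricAlgebra ℝ E, Function.Injective ψ ∧
      ∀ p, ψ p = fun j => symElem (Function.update v i p) (j.val + 1) := by
  choose a b hab using fun j : Fin m => exists_symElem_update_eq v i (j + 1)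
  let ψ : E →ᵃ[ℝ] Fin m → SymmetricAlgebra ℝ E := AffineMap.pi fun j =>
    ((LinearMap.mulRight ℝ (a j)).comp (SymmetricAlgebra.ι ℝ E)).toAffineMap +
      AffineMap.const ℝ E (b j)
  have hψ (p : E) : ψ p = fun j => symElem (Function.update v i p) (j.val + 1) :=
    funext fun j => (hab j p).symm
  refine ⟨ψ, fun p p' hpp => injective_symmetricAlgebra_ι ?_, hψ⟩
  have degree_one : symElem (Function.update v i p) 1 = symElem (Function.update v i p') 1 := by
    simpa only [hψ] using congrFun hpp ⟨0, hm⟩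
  simpa only [symElem_one, ← map_sum, Finset.sum_update_of_mem (Finset.mem_univ i), map_add,
    add_left_inj] using degree_one

theorem sum_offDiag_mul {ι : Type*} [Fintype ι] (a : ι → ℝ) :
    ∑ x ∈ Finset.univ.offDiag, a x.1 * a x.2 = (∑ i, a i) ^ 2 - ∑ i, a i ^ 2 := by
  classical
  rw [eq_sub_iff_add_eq', sq, Finset.sum_mul_sum, ← Finset.sum_product',
    ← Finset.diag_union_offDiag, Finset.sum_union (Finset.disjoint_diag_offDiag _),
    Finset.sum_diag]
  simp only [sq]

theorem sum_offDiag_mul_eq_zero_iff {ι : Type*} [Fintype ι] [Nonempty ι] {a : ι → ℝ}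
    (ha : ∀ i, 0 ≤ a i) :
    ∑ x ∈ Finset.univ.offDiag, a x.1 * a x.2 = 0 ↔ ∃ i, ∀ j, j ≠ i → a j = 0 := by
  rw [Finset.sum_eq_zero_iff_of_nonneg fun x _ => mul_nonneg (ha _) (ha _)]
  simp only [Finset.mem_offDiag, Finset.mem_univ, true_and, Prod.forall, mul_eq_zero]
  constructor
  · intro h
    by_cases hall : ∀ i, a i = 0
    · exact ⟨Classical.arbitrary ι, fun j _ => hall j⟩
    · obtain ⟨i, hi⟩ := not_forall.mp hall
      exact ⟨i, fun j hj => (h i j hj.symm).resolve_left hi⟩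
  · grind

theorem lift_symElem_one (p : Fin m → E) (l : E →ₗ[ℝ] ℝ) :
    SymmetricAlgebra.lift l (symElem p 1) = ∑ i, l (p i) := by
  simp [symElem_one]

theorem two_mul_esymm_two (σ R : Type*) [Fintype σ] [CommRing R] :
    2 * MvPolynomial.esymm σ R 2 = MvPolynomial.psum σ R 1 ^ 2 - MvPolynomial.psum σ R 2 := by
  have newton := MvPolynomial.mul_esymm_eq_sum σ R 2
  have antidiagonal_eq : {a ∈ Finset.HasAntidiagonal.antidiagonal 2 | a.1 < 2} =
      {((0 : ℕ), (2 : ℕ)), (1, 1)} := by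
    decide
  rw [antidiagonal_eq, Finset.sum_pair (by decide), MvPolynomial.esymm_zero,
    MvPolynomial.esymm_one, ← MvPolynomial.psum_one, Nat.cast_ofNat] at newton
  linear_combination newton

theorem two_mul_lift_symElem_two (p : Fin m → E) (l : E →ₗ[ℝ] ℝ) :
    2 * SymmetricAlgebra.lift l (symElem p 2) = (∑ i, l (p i)) ^ 2 - ∑ i, l (p i) ^ 2 := by
  have lift_eq : SymmetricAlgebra.lift l (symElem p 2) =
      MvPolynomial.aeval (fun i => l (p i)) (MvPolynomial.esymm (Fin m) ℝ 2) := by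
    simp [symElem, MvPolynomial.esymm]
  simpa [lift_eq, MvPolynomial.psum] using
    congrArg (MvPolynomial.aeval fun i => l (p i)) (two_mul_esymm_two (Fin m) ℝ)

theorem exists_affineMap_symElem_eq (hm : 1 < m) (h g : E →ᵃ[ℝ] ℝ) :
    ∃ H : (Fin m → SymmetricAlgebra ℝ E) →ᵃ[ℝ] ℝ, ∀ p : Fin m → E,
      H (fun j => symElem p (j.val + 1)) =
        ∑ i, h (p i) + ∑ x ∈ Finset.univ.offDiag, g (p x.1) * g (p x.2) := by
  let liftAt (j : Fin m) (l : E →ₗ[ℝ] ℝ) : (Fin m → SymmetricAlgebra ℝ E) →ₗ[ℝ] ℝ :=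
    (SymmetricAlgebra.lift l).toLinearMap.comp (LinearMap.proj j)
  let i₀ : Fin m := ⟨0, by omega⟩
  let i₁ : Fin m := ⟨1, hm⟩
  refine ⟨(liftAt i₀ h.linear + (2 : ℝ) • liftAt i₁ g.linear +
      (2 * (m - 1) * g 0) • liftAt i₀ g.linear).toAffineMap +
    AffineMap.const ℝ _ (m * h 0 + m * (m - 1) * g 0 ^ 2), fun p => ?_⟩
  have decomp (f : E →ᵃ[ℝ] ℝ) (x : E) : f x = f.linear x + f 0 := congrFun f.decomp x
  have sum_sq : ∑ i, g (p i) ^ 2 = ∑ i, g.linear (p i) ^ 2 + 2 * g 0 * ∑ i, g.linear (p i) +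
      m * g 0 ^ 2 := by
    simp only [decomp g (p _), add_sq, Finset.sum_add_distrib, Finset.sum_const,
      Finset.card_univ, Fintype.card_fin, nsmul_eq_mul, ← Finset.mul_sum, ← Finset.sum_mul]
    ring
  have sum_eq (f : E →ᵃ[ℝ] ℝ) : ∑ i, f (p i) = ∑ i, f.linear (p i) + m * f 0 := by
    simp [decomp f (p _), Finset.sum_add_distrib]
  rw [sum_offDiag_mul fun i => g (p i), sum_sq, sum_eq h, sum_eq g]
  trans ∑ i, h.linear (p i) + 2 * SymmetricAlgebra.lift g.linear (symElem p 2) +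
    2 * (m - 1) * g 0 * ∑ i, g.linear (p i) + (m * h 0 + m * (m - 1) * g 0 ^ 2)
  · simp [liftAt, i₀, i₁, lift_symElem_one]
  · rw [two_mul_lift_symElem_two]
    ring

namespace Exposes

variable {h g : E →ᵃ[ℝ] ℝ} {K F : Set E} {q : E} {ι : Type*} [Fintype ι] {p : ι → E}

theorem sum_nonneg (hF : Exposes h K F) (hp : ∀ i, p i ∈ K) : 0 ≤ ∑ i, h (p i) :=
  Finset.sum_nonneg fun i _ => hF.nonneg _ (hp i)

theorem sum_offDiag_nonneg (hF : Exposes h K F) (hp : ∀ i, p i ∈ K) :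
    0 ≤ ∑ x ∈ Finset.univ.offDiag, h (p x.1) * h (p x.2) :=
  Finset.sum_nonneg fun x _ => mul_nonneg (hF.nonneg _ (hp x.1)) (hF.nonneg _ (hp x.2))

theorem sum_add_sum_offDiag_eq_zero_iff [Nonempty ι] (hF : Exposes h K F) (hq : Exposes g K {q})
    (hp : ∀ i, p i ∈ K) :
    ∑ i, h (p i) + ∑ x ∈ Finset.univ.offDiag, g (p x.1) * g (p x.2) = 0 ↔
      (∀ i, p i ∈ F) ∧ ∃ i, ∀ j, j ≠ i → p j = q := by
  rw [add_eq_zero_iff_of_nonneg (hF.sum_nonneg hp) (hq.sum_offDiag_nonneg hp),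
    Finset.sum_eq_zero_iff_of_nonneg fun i _ => hF.nonneg _ (hp i),
    sum_offDiag_mul_eq_zero_iff fun i => hq.nonneg _ (hp i)]
  simp only [hF.mem_iff, hp, true_and, Finset.mem_univ, true_imp_iff, ← Set.mem_singleton_iff,
    hq.mem_iff]

theorem exists_isFaceOf_convexSym (hF : Exposes h K F) (hconv : Convex ℝ F)
    (hq : Exposes g K {q}) (hqF : q ∈ F) (hm : 1 < m) :
    ∃ ψ : E →ᵃ[ℝ] Fin m → SymmetricAlgebra ℝ E, Function.Injective ψ ∧
      IsFaceOf (convexSym m K) (ψ '' F) := by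
  let i₀ : Fin m := ⟨0, by omega⟩
  have : Nonempty (Fin m) := ⟨i₀⟩
  obtain ⟨ψ, hψ, ψ_apply⟩ := exists_affineMap_symElem_update (by omega) (fun _ => q) i₀
  obtain ⟨H, hH⟩ := exists_affineMap_symElem_eq hm h g
  refine ⟨ψ, hψ, isFaceOf_convexHull_image (H := H) ⟨?_, fun z => ⟨?_, ?_⟩⟩ hconv⟩
  · rintro _ ⟨p, hp, rfl⟩
    rw [hH]
    exact add_nonneg (hF.sum_nonneg hp) (hq.sum_offDiag_nonneg hp)
  · rintro ⟨p, hp, rfl⟩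
    have update_mem (i : Fin m) : Function.update (fun _ => q) i₀ p i ∈ F := by
      rw [Function.update_apply]
      split_ifs
      exacts [hp, hqF]
    have update_mem' (i : Fin m) := hF.subset (update_mem i)
    rw [ψ_apply, hH, hF.sum_add_sum_offDiag_eq_zero_iff hq update_mem']
    exact ⟨⟨_, update_mem', rfl⟩, update_mem, i₀, fun j hj => Function.update_of_ne hj ..⟩
  · rintro ⟨⟨p, hp, rfl⟩, h0⟩
    obtain ⟨hpF, i, hi⟩ := (hF.sum_add_sum_offDiag_eq_zero_iff hq hp).mp (hH p ▸ h0)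
    have p_eq : p = Function.update (fun _ => q) i (p i) := Function.eq_update_iff.mpr ⟨rfl, hi⟩
    refine ⟨p i, hpF i, ?_⟩
    rw [ψ_apply, p_eq, Function.update_self]
    exact funext fun j => symElem_update_const q (p i) i₀ i _

end Exposes

end SymmetricPower

/-! ### Faces of the traveling salesman polytope -/

theorem Exposes.sum {E ι : Type*} [AddCommGroup E] [Module ℝ E] {K : Set E} {s : Finset ι}
    {h : ι → E →ᵃ[ℝ] ℝ} {F : ι → Set E} (hF : ∀ i ∈ s, Exposes (h i) K (F i)) :
    Exposes (∑ i ∈ s, h i) K {p ∈ K | ∀ i ∈ s, p ∈ F i} := by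
  have sum_apply (p : E) : (∑ i ∈ s, h i) p = ∑ i ∈ s, h i p :=
    map_sum (⟨⟨fun f => f p, rfl⟩, fun _ _ => rfl⟩ : (E →ᵃ[ℝ] ℝ) →+ ℝ) h s
  refine ⟨fun p hp => ?_, fun p => and_congr_right fun hp => ?_⟩
  · rw [sum_apply]
    exact Finset.sum_nonneg fun i hi => (hF i hi).nonneg p hp
  · rw [sum_apply, Finset.sum_eq_zero_iff_of_nonneg fun i hi => (hF i hi).nonneg p hp]
    exact forall₂_congr fun i hi => ((hF i hi).mem_iff p).trans (and_iff_right hp)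

theorem tourMatrices_apply_eq_zero_or_one {n : ℕ} {A : Matrix (Fin n) (Fin n) ℝ}
    (hA : A ∈ tourMatrices n) (x y : Fin n) : A x y = 0 ∨ A x y = 1 := by
  obtain ⟨v, p, -, rfl⟩ := hA
  rw [SimpleGraph.adjMatrix_apply]
  split_ifs <;> simp

theorem exists_exposes_tourMatrices_entry {n : ℕ} (x y : Fin n) {b : ℝ} (hb : b = 0 ∨ b = 1) :
    ∃ h, Exposes h (tourMatrices n) {A ∈ tourMatrices n | A x y = b} := by
  let entry : Matrix (Fin n) (Fin n) ℝ →ᵃ[ℝ] ℝ := (Matrix.entryLinearMap ℝ ℝ x y).toAffineMap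
  rcases hb with rfl | rfl
  · refine ⟨entry, fun A hA => ?_, fun A => Iff.rfl⟩
    change 0 ≤ A x y
    rcases tourMatrices_apply_eq_zero_or_one hA x y with h | h <;> simp [h]
  · refine ⟨AffineMap.const ℝ _ 1 - entry, fun A hA => ?_, fun A => ?_⟩
    · change 0 ≤ 1 - A x y
      rcases tourMatrices_apply_eq_zero_or_one hA x y with h | h <;> simp [h]
    · change _ ↔ _ ∧ 1 - A x y = 0
      rw [sub_eq_zero, eq_comm (a := (1 : ℝ)), Set.mem_sep_iff]

theorem exists_exposes_tourMatrices {n : ℕ} (I : Set (Fin n × Fin n))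
    {B : Matrix (Fin n) (Fin n) ℝ} (hB : ∀ x y, B x y = 0 ∨ B x y = 1) :
    ∃ h, Exposes h (tourMatrices n) {A ∈ tourMatrices n | ∀ x ∈ I, A x.1 x.2 = B x.1 x.2} := by
  classical
  choose h hh using fun x : Fin n × Fin n =>
    exists_exposes_tourMatrices_entry x.1 x.2 (hB x.1 x.2)
  refine ⟨∑ x ∈ I.toFinset, h x, ?_⟩
  convert Exposes.sum fun x (_ : x ∈ I.toFinset) => hh x using 1
  ext A
  simp +contextual

theorem exists_exposes_tourMatrices_singleton {n : ℕ} {B : Matrix (Fin n) (Fin n) ℝ}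
    (hB : B ∈ tourMatrices n) : ∃ h, Exposes h (tourMatrices n) {B} := by
  obtain ⟨h, hh⟩ := exists_exposes_tourMatrices Set.univ (tourMatrices_apply_eq_zero_or_one hB)
  refine ⟨h, ?_⟩
  convert hh
  ext A
  constructor
  · rintro rfl
    exact ⟨hB, fun _ _ => rfl⟩
  · exact fun hA => Matrix.ext fun x y => hA.2 (x, y) trivial

theorem exists_exposes_tourMatrix_image_graphTours {n : ℕ} (hn : 3 ≤ n)
    (G : SimpleGraph (Fin n)) :
    ∃ h, Exposes h (tourMatrices n) (tourMatrix '' graphTours G) := by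
  obtain ⟨h, hh⟩ := exists_exposes_tourMatrices {x | ¬ G.Adj x.1 x.2} (B := 0) (by simp)
  exact ⟨h, by simpa [tourMatrix_image_graphTours hn] using hh⟩

/-- The map identifying the ambient space of `STSP n` with the affine span of the tour matrices. -/
noncomputable def tourInclusion (n : ℕ) :
    vectorSpan ℝ (tourMatrices n) →ᵃ[ℝ] Matrix (Fin n) (Fin n) ℝ :=
  (vectorSpan ℝ (tourMatrices n)).subtype.toAffineMap + AffineMap.const ℝ _ (tourCenter n)

theorem tourInclusion_injective (n : ℕ) : Function.Injective (tourInclusion n) :=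
  fun _ _ h => Subtype.ext (add_right_cancel h)

theorem convexHull_tourMatrices_subset_range_tourInclusion (n : ℕ) :
    convexHull ℝ (tourMatrices n) ⊆ Set.range (tourInclusion n) := by
  intro A hA
  have center_mem : tourCenter n ∈ convexHull ℝ (tourMatrices n) := by
    have hne : (finite_tourMatrices n).toFinset.Nonempty := by
      simpa using convexHull_nonempty_iff.mp ⟨A, hA⟩
    simpa only [tourCenter, Set.Finite.coe_toFinset] using
      Finset.centroid_mem_convexHull (R := ℝ) _ hne
  have sub_mem : A - tourCenter n ∈ vectorSpan ℝ (tourMatrices n) := by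
    rw [← direction_affineSpan]
    exact AffineSubspace.vsub_mem_direction (convexHull_subset_affineSpan _ hA)
      (convexHull_subset_affineSpan _ center_mem)
  exact ⟨⟨_, sub_mem⟩, sub_add_cancel _ _⟩

theorem AffinelyIsomorphic.exists_isFaceOf_twoTierTSP_and_romanTSP {V : Type*} [AddCommGroup V]
    [Module ℝ V] {P : Set V} {n : ℕ} {F : Set (Matrix (Fin n) (Fin n) ℝ)}
    (hP : AffinelyIsomorphic P (convexHull ℝ F)) {h : Matrix (Fin n) (Fin n) ℝ →ᵃ[ℝ] ℝ}
    (hF : Exposes h (tourMatrices n) F) (hne : F.Nonempty) :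
    (∃ F', IsFaceOf (twoTierTSP n) F' ∧ AffinelyIsomorphic P F') ∧
      ∀ m : ℕ, 1 < m → ∃ F', IsFaceOf (romanTSP m n) F' ∧ AffinelyIsomorphic P F' := by
  obtain ⟨B, hB⟩ := hne
  have range := convexHull_tourMatrices_subset_range_tourInclusion n
  obtain ⟨q, hq⟩ := range (subset_convexHull ℝ _ (hF.subset hB))
  have iso : AffinelyIsomorphic P (tourInclusion n ⁻¹' convexHull ℝ F) :=
    hP.preimage (tourInclusion_injective n) ((convexHull_mono hF.subset).trans range)
  have conv := (convex_convexHull ℝ F).affine_preimage (tourInclusion n)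
  have exposes_F : Exposes _ (STSP n) (tourInclusion n ⁻¹' convexHull ℝ F) :=
    hF.convexHull.preimage (tourInclusion n)
  obtain ⟨g, hg⟩ := exists_exposes_tourMatrices_singleton (hF.subset hB)
  have exposes_q : Exposes (g.comp (tourInclusion n)) (STSP n) {q} := by
    have := hg.convexHull.preimage (tourInclusion n)
    rwa [convexHull_singleton, ← hq, ← Set.image_singleton,
      (tourInclusion_injective n).preimage_image] at this
  have hqF : q ∈ tourInclusion n ⁻¹' convexHull ℝ F := by
    rw [Set.mem_preimage, hq]
    exact subset_convexHull ℝ _ hB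
  constructor
  · obtain ⟨ψ, hψ, hface⟩ := exposes_F.exists_isFaceOf_convexTensor conv exposes_q
    exact ⟨_, hface, iso.image hψ⟩
  · intro m hm
    obtain ⟨ψ, hψ, hface⟩ := exposes_F.exists_isFaceOf_convexSym conv exposes_q hqF hm
    exact ⟨_, hface, iso.image hψ⟩

/-! ### Polytopes with vertices in the cube -/

theorem IsZeroOnePolytope.exists_eq_convexHull {d : ℕ} {P : Set (Fin d → ℝ)}
    (hP : IsZeroOnePolytope P) :
    ∃ S : Set (Fin d → Bool), P = convexHull ℝ (cubeVertex '' S) := by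
  obtain ⟨⟨X, rfl⟩, hvert⟩ := hP
  set P : Set (Fin d → ℝ) := convexHull ℝ X
  have extremePoints_subset : P.extremePoints ℝ ⊆ Set.range cubeVertex := fun x hx =>
    ⟨fun i => decide (x i = 1), funext fun i => by
      rcases hvert x hx i with h | h <;> simp [cubeVertex, h]⟩
  have finite : (P.extremePoints ℝ).Finite :=
    X.finite_toSet.subset extremePoints_convexHull_subset
  refine ⟨cubeVertex ⁻¹' P.extremePoints ℝ, ?_⟩
  rw [Set.image_preimage_eq_of_subset extremePoints_subset,
    ← (finite.isClosed_convexHull ℝ).closure_eq]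
  exact (closure_convexHull_extremePoints (X.finite_toSet.isCompact_convexHull ℝ)
    (convex_convexHull ℝ _)).symm

theorem exists_affinelyIsomorphic_convexHull_tourMatrix {J : Type*} [Finite J]
    {S : Set (J → Bool)} (hS : S.Nonempty) :
    ∃ N, 3 ≤ N ∧ ∀ n ≥ N, ∃ G : SimpleGraph (Fin n), (graphTours G).Nonempty ∧
      AffinelyIsomorphic (convexHull ℝ (cubeVertex '' S))
        (convexHull ℝ (tourMatrix '' graphTours G)) := by
  -- An additional coordinate with constant value `1` covers the case of an empty `J`.
  let extend (y : J → Bool) : Option J → Bool := fun o => o.elim true y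
  let κ : (J → ℝ) →ᵃ[ℝ] (Option J → ℝ) := AffineMap.pi fun o =>
    o.elim (AffineMap.const ℝ _ 1) fun i => (LinearMap.proj i).toAffineMap
  have κ_injective : Function.Injective κ := fun x y h => funext fun i => congrFun h (some i)
  have κ_cubeVertex (y : J → Bool) : κ (cubeVertex y) = cubeVertex (extend y) := by
    ext (_ | i)
    · simp [κ, extend, cubeVertex]
    · rfl
  obtain ⟨N, hN, hG⟩ := exists_affine_image_eq_tourMatrix_image (hS.image extend)
  refine ⟨N, hN, fun n hn => ?_⟩
  obtain ⟨G, T, hT, image_eq⟩ := hG n hn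
  refine ⟨G, ?_, T.comp κ, ?_⟩
  · rw [← Set.image_nonempty, ← image_eq]
    exact ((hS.image _).image _).image _
  · have image_convexHull : T.comp κ '' convexHull ℝ (cubeVertex '' S) =
        convexHull ℝ (tourMatrix '' graphTours G) := by
      rw [AffineMap.image_convexHull, ← image_eq]
      simp only [Set.image_image, AffineMap.coe_comp, Function.comp_apply, κ_cubeVertex]
    rw [← image_convexHull]
    exact (hT.comp κ_injective).injOn.bijOn_image

theorem mainTheorem9 (d : ℕ) :
    ∃ N : ℕ, 0 < N ∧ ∀ n : ℕ, N ≤ n → ∀ P : Set (Fin d → ℝ), IsZeroOnePolytope P →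
      (∃ F, IsFaceOf (twoTierTSP n) F ∧ AffinelyIsomorphic P F) ∧
      ∀ m : ℕ, 1 < m → ∃ F, IsFaceOf (romanTSP m n) F ∧ AffinelyIsomorphic P F := by
  classical
  choose! N hN hG using fun (S : Set (Fin d → Bool)) (hS : S.Nonempty) =>
    exists_affinelyIsomorphic_convexHull_tourMatrix hS
  refine ⟨Finset.univ.sup N + 1, Nat.succ_pos _, fun n hn P hP => ?_⟩
  obtain ⟨S, rfl⟩ := hP.exists_eq_convexHull
  rcases S.eq_empty_or_nonempty with rfl | hS
  · rw [Set.image_empty, convexHull_empty]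
    exact ⟨⟨∅, isFaceOf_empty _, affinelyIsomorphic_empty _ _⟩,
      fun m _ => ⟨∅, isFaceOf_empty _, affinelyIsomorphic_empty _ _⟩⟩
  · have N_le : N S ≤ n := (Finset.le_sup (Finset.mem_univ S)).trans (Nat.le_of_succ_le hn)
    obtain ⟨G, tours_nonempty, iso⟩ := hG S hS n N_le
    obtain ⟨h, hh⟩ := exists_exposes_tourMatrix_image_graphTours ((hN S hS).trans N_le) G
    exact iso.exists_isFaceOf_twoTierTSP_and_romanTSP hh (tours_nonempty.image _)
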